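/- Let $U\subset\mathbb R^n$ be open and bounded, let $\Omega\subset U$ be a Borel set, and let $F\in\mathcal{DM}^1(U)$, i.e. $F\in L^1(U,\mathbb R^n)$ and the distributional divergence $\operatorname{div}F$ is a finite signed Borel measure on $U$. (Then $\varphi F\in\mathcal{DM}^1(U)$ for every $\varphi\in W^{1,\infty}(U)$, so that $\operatorname{div}(\varphi F)(\Omega)$ is defined.) **Notation.** $(\partial\Omega)_\delta$ is the open $\delta$-neighbourhood of $\partial\Omega$, and $\chi_\delta$ is the tent function equal to $1$ on $(\partial\Omega)_{\delta/2}$, to $2-\frac2\delta\operatorname{dist}(\cdot,\partial\Omega)$ on $(\partial\Omega)_\delta\setminus(\partial\Omega)_{\delta/2}$, and to $0$ elsewhere. $\|\varphi\|_{W^{1,\infty}}=\max\{\|\varphi\|_{L^\infty},\|D\varphi\|_{L^\infty}\}$ with the Euclidean norm for $D\varphi$. $\operatorname{ba}(U)$ is the set of bounded, finitely additive real set functions on the Borel subsets of $U$ that vanish on all Lebesgue null sets; integrals with respect to them are the usual (Dunford) integrals for finitely additive measures, and $\int D\varphi\,d\mu=\sum_j\int \partial_j\varphi\,d\mu_j$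 for $\mu\in\operatorname{ba}(U)^n$. The core of $\mu$ is $\operatorname{cor}\mu=\{x:\ |\mu|(W\cap U)>0\text{ for every open }W\ni x\}$, where $|\mu|$ is the total variation. For $\delta>0$ call a pair $\lambda_F\in\operatorname{ba}(U)$, $\mu_F\in\operatorname{ba}(U)^n$ a *normal trace of $F$ for $\delta$* if $\operatorname{cor}\lambda_F,\operatorname{cor}\mu_F\subset\overline{(\partial\Omega)_\delta\cap U}$ and $$\operatorname{div}(\varphi F)(\Omega)=\int_{(\partial\Omega)_\delta\cap U}\varphi\,d\lambda_F+\int_{(\partial\Omega)_\delta\cap U}D\varphi\,d\mu_F\qquad\text{for all }\varphi\in W^{1,\infty}(U).$$ **Proposition.** 1. There are $\lambda_F,\mu_F$ with $\operatorname{cor}\lambda_F,\operatorname{cor}\mu_F\subset\partial\Omega$ that form a normal trace of $F$ for every $\delta>0$ (i.e. independently of $\delta$) if and only if $$\liminf_{\delta\downarrow0}\ \sup_{\substack{\varphi\in W^{1,\infty}(U)\\ \|\varphi|_{(\partial\Omega)_\delta\cap U}\|_{W^{1,\infty}}\le1}}\operatorname{div}(\chi_\delta\varphi F)(\Omega)<\infty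 .$$ Moreover, whenever a normal trace $(\lambda_F,\mu_F)$ for some $\delta>0$ has both cores in $\partial\Omega$, then for every open set $W\supset\partial\Omega$ $$\operatorname{div}(\varphi F)(\Omega)=\int_{W\cap U}\varphi\,d\lambda_F+\int_{W\cap U}D\varphi\,d\mu_F\qquad\text{for all }\varphi\in W^{1,\infty}(U).$$ 2. For each $\delta>0$, there is a normal trace of $F$ for $\delta$ with $\mu_F=0$ if and only if $$\sup_{\substack{\varphi\in W^{1,\infty}(U)\\ \|\varphi|_{(\partial\Omega)_\delta\cap U}\|_{L^\infty}\le1}}\operatorname{div}(\varphi F)(\Omega)<\infty .$$ 3. There is $\lambda_F$ with $\operatorname{cor}\lambda_F\subset\partial\Omega$ such that $(\lambda_F,0)$ is a normal trace of $F$ for every $\delta>0$ if and only if $$\liminf_{\delta\downarrow0}\ \sup_{\substack{\varphi\in W^{1,\infty}(U)\\ \|\varphi|_{(\partial\Omega)_\delta\cap U}\|_{L^\infty}\le1}}\operatorname{div}(\varphi F)(\Omega)<\infty .$$ -/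

import Mathlib

open MeasureTheory Filter Topology Set
open scoped ENNReal ContDiff

noncomputable section

/-! ### Bounded finitely additive measures, their core, and their integral -/

/-- Bounded, finitely additive, `V`-valued set functions on the measurable subsets of `α` that
vanish on all `σ`-null sets (weak absolute continuity). For an open set `U` of `ℝⁿ` the measures on
the Borel subsets of `U` which vanish on Lebesgue null sets are the elements of
`BddAddMeasure (volume.restrict U) V`: since `volume.restrict U` vanishes outside `U`, so do they.
The values on non-measurable sets play no role. -/
structure BddAddMeasure {α : Type*} [MeasurableSpace α] (σ : Measure α)
    (V : Type*) [NormedAddCommGroup V] where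
  toFun : Set α → V
  additive : ∀ A B : Set α, MeasurableSet A → MeasurableSet B → Disjoint A B →
    toFun (A ∪ B) = toFun A + toFun B
  bounded : ∃ C : ℝ, ∀ A : Set α, MeasurableSet A → ‖toFun A‖ ≤ C
  weaklyAbsCont : ∀ A : Set α, MeasurableSet A → σ A = 0 → toFun A = 0

namespace BddAddMeasure

variable {α : Type*} [MeasurableSpace α] {σ : Measure α}
  {V : Type*} [NormedAddCommGroup V]

instance : Zero (BddAddMeasure σ V) where
  zero :=
    { toFun := fun _ => 0
      additive := fun _ _ _ _ _ => (add_zero 0).symm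
      bounded := ⟨0, fun _ _ => norm_zero.le⟩
      weaklyAbsCont := fun _ _ _ => rfl }

/-- The total variation `|μ|(A)`: supremum of `∑ |μ(B)|` over the finite partitions of `A` into
measurable sets `B`. -/
def totalVariation (μ : BddAddMeasure σ V) (A : Set α) : ℝ≥0∞ :=
  ⨆ (P : Finset (Set α)) (_ : (∀ B ∈ P, MeasurableSet B) ∧
    (P : Set (Set α)).PairwiseDisjoint id ∧ ⋃₀ (P : Set (Set α)) = A), ∑ B ∈ P, ‖μ.toFun B‖ₑ

/-- The outer measure `|μ|^*(A)` of the total variation. -/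
def outerVariation (μ : BddAddMeasure σ V) (A : Set α) : ℝ≥0∞ :=
  ⨅ (B : Set α) (_ : MeasurableSet B ∧ A ⊆ B), μ.totalVariation B

/-- Convergence in measure of simple functions `s k` to `f`. -/
def TendstoInVariation (μ : BddAddMeasure σ ℝ) (s : ℕ → SimpleFunc α ℝ) (f : α → ℝ) : Prop :=
  ∀ ε : ℝ, 0 < ε → Tendsto (fun k => μ.outerVariation {x | ε < |s k x - f x|}) atTop (𝓝 0)

/-- The integral of a simple function. -/
def simpleIntegral (μ : BddAddMeasure σ ℝ) (s : SimpleFunc α ℝ) : ℝ :=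
  ∑ y ∈ s.range, y * μ.toFun (s ⁻¹' {y})

/-- `∫ |s| d|μ|` for a simple function `s`. -/
def simpleNorm (μ : BddAddMeasure σ ℝ) (s : SimpleFunc α ℝ) : ℝ≥0∞ :=
  ∑ y ∈ s.range, ‖y‖ₑ * μ.totalVariation (s ⁻¹' {y})

/-- `f` is `μ`-integrable with integral `I`: there is a determining sequence of simple functions
converging to `f` in measure, Cauchy in mean, and with integrals converging to `I`. -/
def HasIntegral (μ : BddAddMeasure σ ℝ) (f : α → ℝ) (I : ℝ) : Prop :=
  ∃ s : ℕ → SimpleFunc α ℝ, μ.TendstoInVariation s f ∧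
    Tendsto (fun p : ℕ × ℕ => μ.simpleNorm (s p.1 - s p.2)) atTop (𝓝 0) ∧
    Tendsto (fun k => μ.simpleIntegral (s k)) atTop (𝓝 I)

open Classical in
/-- The integral of `f` with respect to the finitely additive measure `μ`. -/
def integral (μ : BddAddMeasure σ ℝ) (f : α → ℝ) : ℝ :=
  if h : ∃ I, μ.HasIntegral f I then h.choose else 0

/-- The integral `∫_A f dμ`. -/
def setIntegral (μ : BddAddMeasure σ ℝ) (A : Set α) (f : α → ℝ) : ℝ :=
  μ.integral (A.indicator f)

/-- The `j`-th component of a vector-valued measure. -/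
def component {n : ℕ} (μ : BddAddMeasure σ (EuclideanSpace ℝ (Fin n))) (j : Fin n) :
    BddAddMeasure σ ℝ where
  toFun A := μ.toFun A j
  additive A B hA hB h := by rw [μ.additive A B hA hB h]; rfl
  bounded := μ.bounded.imp fun _ hC A hA => (PiLp.norm_apply_le (μ.toFun A) j).trans (hC A hA)
  weaklyAbsCont A hA h := by rw [μ.weaklyAbsCont A hA h]; rfl

/-- The integral `∫_A G dμ = ∑ⱼ ∫_A Gⱼ dμⱼ` of a vector field with respect to a vector-valued
measure. -/
def setIntegralVec {n : ℕ} (μ : BddAddMeasure σ (EuclideanSpace ℝ (Fin n))) (A : Set α)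
    (G : α → EuclideanSpace ℝ (Fin n)) : ℝ :=
  ∑ j, (μ.component j).setIntegral A (fun x => G x j)

/-- The core of a measure on `U`: all points `x` such that `|μ|(W ∩ U) > 0` for every open
neighbourhood `W` of `x`. For bounded `U` the point at infinity never belongs to it. -/
def core {X : Type*} [TopologicalSpace X] [MeasurableSpace X] {τ : Measure X} {U : Set X}
    (μ : BddAddMeasure (τ.restrict U) V) : Set X :=
  {x | ∀ W : Set X, IsOpen W → x ∈ W → 0 < μ.totalVariation (W ∩ U)}

end BddAddMeasure

/-! ### Sobolev functions and fields with divergence measure -/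

/-- Test functions: `ψ ∈ C_c^∞(U)`. -/
def IsTestFunction {n : ℕ} (U : Set (EuclideanSpace ℝ (Fin n)))
    (ψ : EuclideanSpace ℝ (Fin n) → ℝ) : Prop :=
  ContDiff ℝ ∞ ψ ∧ HasCompactSupport ψ ∧ tsupport ψ ⊆ U

/-- `g` is the weak gradient of `φ` on `U`. -/
def IsWeakGradient {n : ℕ} (U : Set (EuclideanSpace ℝ (Fin n)))
    (φ : EuclideanSpace ℝ (Fin n) → ℝ)
    (g : EuclideanSpace ℝ (Fin n) → EuclideanSpace ℝ (Fin n)) : Prop :=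
  ∀ ψ, IsTestFunction U ψ → ∫ x in U, φ x • gradient ψ x = - ∫ x in U, ψ x • g x

/-- The Sobolev space `W^{1,∞}(U)`; an element consists of (a representative of) a function `φ` and
(a representative of) its weak gradient `Dφ`. -/
structure SobolevW1Inf {n : ℕ} (U : Set (EuclideanSpace ℝ (Fin n))) where
  toFun : EuclideanSpace ℝ (Fin n) → ℝ
  grad : EuclideanSpace ℝ (Fin n) → EuclideanSpace ℝ (Fin n)
  memLp_toFun : MemLp toFun ∞ (volume.restrict U)
  memLp_grad : MemLp grad ∞ (volume.restrict U)
  isWeakGradient : IsWeakGradient U toFun grad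

/-- The norm of the restriction of `φ` in `L^∞(A)`, for `A ⊆ U`. -/
def SobolevW1Inf.supNormOn {n : ℕ} {U : Set (EuclideanSpace ℝ (Fin n))} (φ : SobolevW1Inf U)
    (A : Set (EuclideanSpace ℝ (Fin n))) : ℝ≥0∞ :=
  eLpNorm φ.toFun ∞ (volume.restrict A)

/-- The norm of the restriction of `φ` in `W^{1,∞}(A)`, for `A ⊆ U` open. -/
def SobolevW1Inf.normOn {n : ℕ} {U : Set (EuclideanSpace ℝ (Fin n))} (φ : SobolevW1Inf U)
    (A : Set (EuclideanSpace ℝ (Fin n))) : ℝ≥0∞ :=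
  max (eLpNorm φ.toFun ∞ (volume.restrict A)) (eLpNorm φ.grad ∞ (volume.restrict A))

/-- The finite signed Borel measure `ν` on `U` (extended by zero) is the distributional divergence
of `F` on `U`. -/
def IsDivMeasure {n : ℕ} (U : Set (EuclideanSpace ℝ (Fin n)))
    (F : EuclideanSpace ℝ (Fin n) → EuclideanSpace ℝ (Fin n))
    (ν : SignedMeasure (EuclideanSpace ℝ (Fin n))) : Prop :=
  ν.restrict U = ν ∧
    ∀ ψ, IsTestFunction U ψ →
      ∫ x in U, inner ℝ (F x) (gradient ψ x) = - VectorMeasure.integral ν ψ (.lsmul ℝ ℝ)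

/-- `F ∈ 𝒟ℳ¹(U)`: an integrable field whose distributional divergence is a finite signed
measure. -/
def MemDM1 {n : ℕ} (U : Set (EuclideanSpace ℝ (Fin n)))
    (F : EuclideanSpace ℝ (Fin n) → EuclideanSpace ℝ (Fin n)) : Prop :=
  MemLp F 1 (volume.restrict U) ∧ ∃ ν, IsDivMeasure U F ν

open Classical in
/-- The measure `div F` of a field with divergence measure on `U`. -/
def divMeasure {n : ℕ} (U : Set (EuclideanSpace ℝ (Fin n)))
    (F : EuclideanSpace ℝ (Fin n) → EuclideanSpace ℝ (Fin n)) :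
    SignedMeasure (EuclideanSpace ℝ (Fin n)) :=
  if h : ∃ ν, IsDivMeasure U F ν then h.choose else 0

/-! ### Boundary neighbourhoods, tent functions, and the Gauss-Green formula -/

/-- `(∂Ω)_δ ∩ U`, with `(∂Ω)_δ` the open `δ`-neighbourhood of the boundary. -/
def bdryNhd {n : ℕ} (U Ω : Set (EuclideanSpace ℝ (Fin n))) (δ : ℝ) :
    Set (EuclideanSpace ℝ (Fin n)) :=
  Metric.thickening δ (frontier Ω) ∩ U

open Classical in
/-- The tent function of `K` and `δ`: `1` on `K_{δ/2}`, `2 - (2/δ) dist(·, K)` on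
`K_δ \ K_{δ/2}`, and `0` outside `K_δ`. -/
def tent {n : ℕ} (K : Set (EuclideanSpace ℝ (Fin n))) (δ : ℝ) (x : EuclideanSpace ℝ (Fin n)) : ℝ :=
  if x ∈ Metric.thickening (δ / 2) K then 1
  else if x ∈ Metric.thickening δ K then 2 - 2 / δ * Metric.infDist x K
  else 0

/-- The Gauss-Green formula
`div(φF)(Ω) = ∫_A φ dlam + ∫_A Dφ dμ` for all `φ ∈ W^{1,∞}(U)`. -/
def GaussGreenOn {n : ℕ} {U : Set (EuclideanSpace ℝ (Fin n))} (Ω : Set (EuclideanSpace ℝ (Fin n)))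
    (F : EuclideanSpace ℝ (Fin n) → EuclideanSpace ℝ (Fin n)) (A : Set (EuclideanSpace ℝ (Fin n)))
    (lam : BddAddMeasure (volume.restrict U) ℝ)
    (μ : BddAddMeasure (volume.restrict U) (EuclideanSpace ℝ (Fin n))) : Prop :=
  ∀ φ : SobolevW1Inf U,
    divMeasure U (fun x => φ.toFun x • F x) Ω
      = lam.setIntegral A φ.toFun + μ.setIntegralVec A φ.grad

/-- `(lam, μ)` is a normal trace of `F` on `∂Ω` for `δ`: both cores lie in the closure of
`(∂Ω)_δ ∩ U`, and the Gauss-Green formula holds with integrals over `(∂Ω)_δ ∩ U`. -/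
def IsNormalTrace {n : ℕ} {U : Set (EuclideanSpace ℝ (Fin n))} (Ω : Set (EuclideanSpace ℝ (Fin n)))
    (F : EuclideanSpace ℝ (Fin n) → EuclideanSpace ℝ (Fin n)) (δ : ℝ)
    (lam : BddAddMeasure (volume.restrict U) ℝ)
    (μ : BddAddMeasure (volume.restrict U) (EuclideanSpace ℝ (Fin n))) : Prop :=
  lam.core ⊆ closure (bdryNhd U Ω δ) ∧ μ.core ⊆ closure (bdryNhd U Ω δ) ∧
    GaussGreenOn Ω F (bdryNhd U Ω δ) lam μ

/-- The supremum of `div(χ_δ φ F)(Ω)`, with the tent function `χ_δ` of `∂Ω`, over all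
`φ ∈ W^{1,∞}(U)` whose restriction to `(∂Ω)_δ ∩ U` has `W^{1,∞}`-norm at most `1`. -/
def tentTraceBound {n : ℕ} (U Ω : Set (EuclideanSpace ℝ (Fin n)))
    (F : EuclideanSpace ℝ (Fin n) → EuclideanSpace ℝ (Fin n)) (δ : ℝ) : EReal :=
  ⨆ (φ : SobolevW1Inf U) (_ : φ.normOn (bdryNhd U Ω δ) ≤ 1),
    ((divMeasure U (fun x => (tent (frontier Ω) δ x * φ.toFun x) • F x) Ω : ℝ) : EReal)

/-- The supremum of `div(φ F)(Ω)` over all `φ ∈ W^{1,∞}(U)` whose restriction to `(∂Ω)_δ ∩ U` has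
`L^∞`-norm at most `1`. -/
def supTraceBound {n : ℕ} (U Ω : Set (EuclideanSpace ℝ (Fin n)))
    (F : EuclideanSpace ℝ (Fin n) → EuclideanSpace ℝ (Fin n)) (δ : ℝ) : EReal :=
  ⨆ (φ : SobolevW1Inf U) (_ : φ.supNormOn (bdryNhd U Ω δ) ≤ 1),
    ((divMeasure U (fun x => φ.toFun x • F x) Ω : ℝ) : EReal)

end

/-! The number `div(φF)(Ω)` depends only on `φ` near `∂Ω`. Indeed, let `G` have divergence measure
and vanish on `U` near `∂Ω`. Then `div G` vanishes there too. A smooth cutoff supported in the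
interior of `Ω` and equal to one near the rest of the closure of `Ω` has zero gradient wherever `G`
is nonzero, so it shows that `div G (Ω) = 0` (`IsDivMeasure.apply_eq_zero`). Hence the tent function
can be dropped, and both suprema become instances of `weightedTraceBound`, with weight `κ = 1` or `κ
= 0` on the gradient. Shrinking `δ` weakens the constraint on `φ`, so the supremum is antitone in
`δ`, and a finite lower limit at zero is a bound uniform in all `δ > 0`.

From bounds to measures: by the product rule (`IsDivMeasure.exists_smul`) and uniqueness of the
divergence, `φ ↦ div(φF)(Ω)` is linear on `W^{1,∞}(U)`. It is dominated by `C` times the infimum of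
the seminorms on the given neighbourhoods, which is sublinear because the neighbourhoods are
directed. Hahn-Banach extends it to a functional `ℓ` on `L^∞ × L^∞` pairs. The set functions `B ↦
ℓ(1_B, 0)` and `B ↦ ℓ(0, 1_B e_j)` are the required measures; uniform density of simple functions
gives the formula, and the seminorm bound puts the cores in the closure of every neighbourhood used.
For `κ = 0` the functional ignores the gradient, so the vector measure vanishes
(`exists_gaussGreenOn`).

From measures to bounds: the integral of an essentially bounded function is at most its supremum
times the total variation, which is finite. Finally, since `U` is bounded, a compactness argument
shows that a measure is concentrated on every neighbourhood of its core, so the domain of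
integration may be any open set containing `∂Ω`. -/

/-! ### Finitely additive set functions and their variation -/

namespace BddAddMeasure

variable {α : Type*} [MeasurableSpace α] {σ : Measure α}
  {V : Type*} [NormedAddCommGroup V]

theorem toFun_empty (μ : BddAddMeasure σ V) : μ.toFun ∅ = 0 :=
  μ.weaklyAbsCont ∅ .empty measure_empty

theorem toFun_biUnion (μ : BddAddMeasure σ V) {ι : Type*} (s : Finset ι) (B : ι → Set α)
    (hB : ∀ i ∈ s, MeasurableSet (B i)) (hd : (s : Set ι).PairwiseDisjoint B) :
    μ.toFun (⋃ i ∈ s, B i) = ∑ i ∈ s, μ.toFun (B i) := by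
  classical
  induction s using Finset.induction_on with
  | empty => simp [toFun_empty]
  | insert a s ha ih =>
    rw [Finset.set_biUnion_insert, Finset.sum_insert ha, μ.additive, ih]
    · exact fun i hi => hB i (Finset.mem_insert_of_mem hi)
    · exact hd.subset (by simp)
    · exact hB a (Finset.mem_insert_self a s)
    · exact Finset.measurableSet_biUnion s fun i hi => hB i (Finset.mem_insert_of_mem hi)
    · refine disjoint_iUnion₂_right.2 fun i hi => hd (by simp) (by simp [hi]) ?_
      rintro rfl
      exact ha hi

/-! ### Total variation -/

/-- Indexed pieces may coincide as sets. Being disjoint they then are empty, where `μ` vanishes, so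
passing to the set of pieces loses nothing. -/
theorem sum_enorm_le_totalVariation (μ : BddAddMeasure σ V) {ι : Type*} (s : Finset ι)
    (B : ι → Set α) (hB : ∀ i ∈ s, MeasurableSet (B i)) (hd : (s : Set ι).PairwiseDisjoint B) :
    ∑ i ∈ s, ‖μ.toFun (B i)‖ₑ ≤ μ.totalVariation (⋃ i ∈ s, B i) := by
  classical
  rw [← Finset.sum_image_of_disjoint (f := B) (g := fun A => ‖μ.toFun A‖ₑ)
    (by simp [toFun_empty]) hd]
  refine le_iSup₂_of_le (s.image B) ⟨?_, ?_, ?_⟩ le_rfl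
  · simpa using hB
  · rw [Finset.coe_image]
    rintro _ ⟨i, hi, rfl⟩ _ ⟨j, hj, rfl⟩ hij
    exact hd hi hj fun h => hij (h ▸ rfl)
  · simp

theorem enorm_le_totalVariation (μ : BddAddMeasure σ V) {A : Set α} (hA : MeasurableSet A) :
    ‖μ.toFun A‖ₑ ≤ μ.totalVariation A := by
  simpa using μ.sum_enorm_le_totalVariation {A} id (by simpa using hA) (by simp)

theorem totalVariation_union (μ : BddAddMeasure σ V) {A B : Set α} (hA : MeasurableSet A)
    (hB : MeasurableSet B) (h : Disjoint A B) :
    μ.totalVariation (A ∪ B) = μ.totalVariation A + μ.totalVariation B := by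
  classical
  apply le_antisymm
  · refine iSup₂_le fun P ⟨hP, hd, hU⟩ => ?_
    have key : ∀ C : Set α, MeasurableSet C → C ⊆ A ∪ B →
        ∑ D ∈ P, ‖μ.toFun (D ∩ C)‖ₑ ≤ μ.totalVariation C := by
      intro C hC hCU
      refine (μ.sum_enorm_le_totalVariation P (fun D => D ∩ C)
        (fun D hD => (hP D hD).inter hC)
        (hd.mono_on fun D _ => inter_subset_left)).trans_eq ?_
      congr 1
      rw [← iUnion₂_inter]
      refine inter_eq_right.2 fun x hx => ?_
      have : x ∈ ⋃₀ (P : Set (Set α)) := hU ▸ hCU hx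
      simpa using this
    calc ∑ D ∈ P, ‖μ.toFun D‖ₑ ≤ ∑ D ∈ P, (‖μ.toFun (D ∩ A)‖ₑ + ‖μ.toFun (D ∩ B)‖ₑ) := by
          refine Finset.sum_le_sum fun D hD => ?_
          have hDU : D = (D ∩ A) ∪ (D ∩ B) := by
            rw [← inter_union_distrib_left, eq_comm, inter_eq_left, ← hU]
            exact subset_sUnion_of_mem hD
          have := μ.additive (D ∩ A) (D ∩ B) ((hP D hD).inter hA) ((hP D hD).inter hB)
            (h.mono inter_subset_right inter_subset_right)
          rw [← hDU] at this
          rw [this]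
          exact enorm_add_le _ _
      _ ≤ _ := by
          rw [Finset.sum_add_distrib]
          exact add_le_add (key A hA subset_union_left) (key B hB subset_union_right)
  -- The two partitions are joined as a disjoint sum of index sets, because the empty set may belong
  -- to both.
  · refine ENNReal.biSup_add_biSup_le' ⟨{A}, by simpa using hA⟩ ⟨{B}, by simpa using hB⟩ ?_
    rintro P ⟨hP, hPd, rfl⟩ Q ⟨hQ, hQd, rfl⟩
    refine (Finset.sum_disjSum P Q (fun i => ‖μ.toFun (Sum.elim id id i)‖ₑ)).symm.trans_le ?_
    refine (μ.sum_enorm_le_totalVariation (P.disjSum Q) (Sum.elim id id) ?_ ?_).trans_eq ?_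
    · rintro (i | i) hi
      · exact hP i (by simpa using hi)
      · exact hQ i (by simpa using hi)
    · rintro (i | i) hi (j | j) hj hij
      · exact hPd (by simpa using hi) (by simpa using hj) (by simpa using hij)
      · exact h.mono (subset_sUnion_of_mem (by simpa using hi))
          (subset_sUnion_of_mem (by simpa using hj))
      · exact h.symm.mono (subset_sUnion_of_mem (by simpa using hi))
          (subset_sUnion_of_mem (by simpa using hj))
      · exact hQd (by simpa using hi) (by simpa using hj) (by simpa using hij)
    · congr 1
      ext x
      simp

theorem totalVariation_mono (μ : BddAddMeasure σ V) {A B : Set α} (hA : MeasurableSet A)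
    (hB : MeasurableSet B) (h : A ⊆ B) : μ.totalVariation A ≤ μ.totalVariation B := by
  rw [← union_sdiff_cancel h, μ.totalVariation_union hA (hB.diff hA) disjoint_sdiff_right]
  exact le_self_add

theorem totalVariation_union_le (μ : BddAddMeasure σ V) {A B : Set α} (hA : MeasurableSet A)
    (hB : MeasurableSet B) :
    μ.totalVariation (A ∪ B) ≤ μ.totalVariation A + μ.totalVariation B := by
  rw [← union_sdiff_self, μ.totalVariation_union hA (hB.diff hA) disjoint_sdiff_right]
  gcongr
  exact μ.totalVariation_mono (hB.diff hA) hB sdiff_subset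

theorem totalVariation_eq_zero_of_forall (μ : BddAddMeasure σ V) {A : Set α}
    (h : ∀ B ⊆ A, MeasurableSet B → μ.toFun B = 0) : μ.totalVariation A = 0 := by
  refine nonpos_iff_eq_zero.1 (iSup₂_le fun P ⟨hP, _, hU⟩ => ?_)
  rw [Finset.sum_eq_zero]
  intro B hB
  rw [h B (hU ▸ subset_sUnion_of_mem hB) (hP B hB), enorm_zero]

theorem totalVariation_eq_zero_of_null (μ : BddAddMeasure σ V) {A : Set α} (h : σ A = 0) :
    μ.totalVariation A = 0 :=
  μ.totalVariation_eq_zero_of_forall fun B hBA hB => μ.weaklyAbsCont B hB (measure_mono_null hBA h)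

/-- Grouping the pieces of a partition by the sign of their value turns each group into the value of
`μ` on a single set, so every partition sum is at most `2C`. -/
theorem totalVariation_lt_top (μ : BddAddMeasure σ ℝ) (A : Set α) : μ.totalVariation A < ⊤ := by
  obtain ⟨C, hC⟩ := μ.bounded
  refine lt_of_le_of_lt (b := ENNReal.ofReal (C + C)) ?_ ENNReal.ofReal_lt_top
  refine iSup₂_le fun P ⟨hP, hd, _⟩ => ?_
  have key : ∀ p : Set α → Prop, ∀ [DecidablePred p],
      |∑ B ∈ P.filter p, μ.toFun B| ≤ C := by
    intro p _
    have := hC (⋃ B ∈ P.filter p, B) (Finset.measurableSet_biUnion _ fun B hB =>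
      hP B (Finset.mem_filter.1 hB).1)
    rwa [μ.toFun_biUnion (P.filter p) (fun B => B) (fun B hB => hP B (Finset.mem_filter.1 hB).1)
      (hd.subset (by intro B; simp; tauto))] at this
  calc ∑ B ∈ P, ‖μ.toFun B‖ₑ = ENNReal.ofReal (∑ B ∈ P, |μ.toFun B|) := by
        rw [ENNReal.ofReal_sum_of_nonneg fun _ _ => abs_nonneg _]
        exact Finset.sum_congr rfl fun B _ => Real.enorm_eq_ofReal_abs _
    _ ≤ _ := by
        refine ENNReal.ofReal_le_ofReal ?_
        rw [← Finset.sum_filter_add_sum_filter_not P (fun B => 0 ≤ μ.toFun B)]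
        refine add_le_add ?_ ?_
        · rw [Finset.sum_congr rfl fun B hB => abs_of_nonneg (Finset.mem_filter.1 hB).2]
          exact (le_abs_self _).trans (key _)
        · rw [Finset.sum_congr rfl fun B hB =>
            abs_of_neg (not_le.1 (Finset.mem_filter.1 hB).2), Finset.sum_neg_distrib]
          exact (neg_le_abs _).trans (key _)

theorem totalVariation_component_le {n : ℕ} (μ : BddAddMeasure σ (EuclideanSpace ℝ (Fin n)))
    (j : Fin n) (A : Set α) : (μ.component j).totalVariation A ≤ μ.totalVariation A := by
  refine iSup₂_mono fun P hP => Finset.sum_le_sum fun B _ => ?_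
  exact enorm_le_iff_norm_le.2 (PiLp.norm_apply_le (μ.toFun B) j)

/-- The total variation as a real-valued set function. -/
noncomputable def variationReal (μ : BddAddMeasure σ ℝ) (A : Set α) : ℝ :=
  (μ.totalVariation A).toReal

theorem variationReal_nonneg (μ : BddAddMeasure σ ℝ) (A : Set α) : 0 ≤ μ.variationReal A :=
  ENNReal.toReal_nonneg

theorem variationReal_union (μ : BddAddMeasure σ ℝ) {A B : Set α} (hA : MeasurableSet A)
    (hB : MeasurableSet B) (h : Disjoint A B) :
    μ.variationReal (A ∪ B) = μ.variationReal A + μ.variationReal B := by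
  rw [variationReal, μ.totalVariation_union hA hB h,
    ENNReal.toReal_add (μ.totalVariation_lt_top A).ne (μ.totalVariation_lt_top B).ne]
  rfl

theorem abs_toFun_le_variationReal (μ : BddAddMeasure σ ℝ) {A : Set α} (hA : MeasurableSet A) :
    |μ.toFun A| ≤ μ.variationReal A := by
  have := ENNReal.toReal_mono (μ.totalVariation_lt_top A).ne (μ.enorm_le_totalVariation hA)
  simpa [variationReal] using this

end BddAddMeasure

/-! ### Simple functions and finitely additive set functions -/

namespace MeasureTheory.SimpleFunc

variable {α : Type*} [MeasurableSpace α] {m : Set α → ℝ}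

/-- The integral of a simple function with respect to a real-valued set function. -/
noncomputable def setSum (m : Set α → ℝ) (s : SimpleFunc α ℝ) : ℝ :=
  ∑ y ∈ s.range, y * m (s ⁻¹' {y})

theorem setSum_eq_setToSimpleFunc (m : Set α → ℝ) (s : SimpleFunc α ℝ) :
    s.setSum m = s.setToSimpleFunc fun A => m A • ContinuousLinearMap.id ℝ ℝ := by
  simp [setSum, setToSimpleFunc, mul_comm]

/-- The zero measure makes the finiteness conditions in `FinMeasAdditive` vacuous, so the algebra of
`setToSimpleFunc` becomes available for any additive set function. -/
theorem finMeasAdditive_smul_id (hm : ∀ A B, MeasurableSet A → MeasurableSet B → Disjoint A B →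
    m (A ∪ B) = m A + m B) :
    FinMeasAdditive (0 : Measure α) fun A => m A • ContinuousLinearMap.id ℝ ℝ :=
  fun A B hA hB _ _ h => by simp only [hm A B hA hB h, add_smul]

theorem setSum_add (hm : ∀ A B, MeasurableSet A → MeasurableSet B → Disjoint A B →
    m (A ∪ B) = m A + m B) (s t : SimpleFunc α ℝ) :
    (s + t).setSum m = s.setSum m + t.setSum m := by
  simp only [setSum_eq_setToSimpleFunc]
  exact setToSimpleFunc_add _ (finMeasAdditive_smul_id hm) (by simp) (by simp)

theorem setSum_sub (hm : ∀ A B, MeasurableSet A → MeasurableSet B → Disjoint A B →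
    m (A ∪ B) = m A + m B) (s t : SimpleFunc α ℝ) :
    (s - t).setSum m = s.setSum m - t.setSum m := by
  simp only [setSum_eq_setToSimpleFunc]
  exact setToSimpleFunc_sub _ (finMeasAdditive_smul_id hm) (by simp) (by simp)

theorem setSum_nonneg (hm : ∀ A, 0 ≤ m A) {s : SimpleFunc α ℝ} (hs : ∀ x, 0 ≤ s x) :
    0 ≤ s.setSum m := by
  refine Finset.sum_nonneg fun y hy => mul_nonneg ?_ (hm _)
  obtain ⟨x, rfl⟩ := SimpleFunc.mem_range.1 hy
  exact hs x

theorem setSum_mono (hm : ∀ A B, MeasurableSet A → MeasurableSet B → Disjoint A B →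
    m (A ∪ B) = m A + m B) (h0 : ∀ A, 0 ≤ m A) {s t : SimpleFunc α ℝ} (h : ∀ x, s x ≤ t x) :
    s.setSum m ≤ t.setSum m := by
  rw [← sub_nonneg, ← setSum_sub hm]
  exact setSum_nonneg h0 fun x => sub_nonneg.2 (h x)

theorem setSum_map (hm : ∀ A B, MeasurableSet A → MeasurableSet B → Disjoint A B →
    m (A ∪ B) = m A + m B) (s : SimpleFunc α ℝ) {g : ℝ → ℝ} (hg : g 0 = 0) :
    (s.map g).setSum m = ∑ y ∈ s.range, g y * m (s ⁻¹' {y}) := by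
  rw [setSum_eq_setToSimpleFunc,
    map_setToSimpleFunc _ (finMeasAdditive_smul_id hm) (by simp) hg]
  simp [mul_comm]

theorem setSum_const (m : Set α → ℝ) (h : m ∅ = 0) (c : ℝ) :
    (SimpleFunc.const α c).setSum m = c * m univ := by
  cases isEmpty_or_nonempty α
  · simp [setSum, h, univ_eq_empty_iff.2 ‹_›]
  · have : Function.const α c ⁻¹' {c} = univ := by ext; simp
    simp [setSum, this]

theorem setSum_piecewise_const (hm : ∀ A B, MeasurableSet A → MeasurableSet B → Disjoint A B →
    m (A ∪ B) = m A + m B) {A : Set α} (hA : MeasurableSet A) (c : ℝ) :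
    (SimpleFunc.piecewise A hA (SimpleFunc.const α c) (SimpleFunc.const α 0)).setSum m
      = c * m A := by
  have h := setToSimpleFunc_indicator (fun A => m A • ContinuousLinearMap.id ℝ ℝ)
    (finMeasAdditive_smul_id hm).map_empty_eq_zero hA c
  rw [setSum_eq_setToSimpleFunc, h]
  simp [mul_comm]

end MeasureTheory.SimpleFunc

namespace BddAddMeasure

variable {α : Type*} [MeasurableSpace α] {σ : Measure α} (μ : BddAddMeasure σ ℝ)

/-! ### The integral -/

theorem simpleIntegral_sub (s t : SimpleFunc α ℝ) :
    μ.simpleIntegral (s - t) = μ.simpleIntegral s - μ.simpleIntegral t :=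
  SimpleFunc.setSum_sub μ.additive s t

theorem setSum_abs_eq (s : SimpleFunc α ℝ) :
    (s.map abs).setSum μ.variationReal = ∑ y ∈ s.range, |y| * μ.variationReal (s ⁻¹' {y}) :=
  SimpleFunc.setSum_map (fun _ _ => μ.variationReal_union) s abs_zero

theorem simpleNorm_eq (s : SimpleFunc α ℝ) :
    μ.simpleNorm s = ENNReal.ofReal ((s.map abs).setSum μ.variationReal) := by
  rw [setSum_abs_eq, ENNReal.ofReal_sum_of_nonneg fun y _ =>
    mul_nonneg (abs_nonneg y) (μ.variationReal_nonneg _)]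
  refine Finset.sum_congr rfl fun y _ => ?_
  rw [ENNReal.ofReal_mul (abs_nonneg y), Real.enorm_eq_ofReal_abs, variationReal,
    ENNReal.ofReal_toReal (μ.totalVariation_lt_top _).ne]

theorem abs_simpleIntegral_le (s : SimpleFunc α ℝ) :
    |μ.simpleIntegral s| ≤ (s.map abs).setSum μ.variationReal := by
  rw [setSum_abs_eq]
  refine (Finset.abs_sum_le_sum_abs _ _).trans (Finset.sum_le_sum fun y _ => ?_)
  rw [abs_mul]
  exact mul_le_mul_of_nonneg_left
    (μ.abs_toFun_le_variationReal (s.measurableSet_fiber y)) (abs_nonneg y)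

theorem variationReal_empty : μ.variationReal ∅ = 0 := by
  rw [variationReal, μ.totalVariation_eq_zero_of_null measure_empty, ENNReal.toReal_zero]

theorem exists_abs_le (s : SimpleFunc α ℝ) : ∃ M, 0 ≤ M ∧ ∀ x, |s x| ≤ M := by
  obtain ⟨M, hM⟩ := s.finite_range.isBounded.exists_norm_le
  exact ⟨|M|, abs_nonneg M, fun x => (hM _ (mem_range_self x)).trans (le_abs_self M)⟩

/-- The exceptional set lies in a measurable `σ`-null set, on which the crude bound of `s` costs
nothing because the variation vanishes there. -/
theorem setSum_abs_le_of_ae (s : SimpleFunc α ℝ) {c : ℝ} (hc : 0 ≤ c)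
    (h : ∀ᵐ x ∂σ, |s x| ≤ c) :
    (s.map abs).setSum μ.variationReal ≤ c * μ.variationReal univ := by
  obtain ⟨M, hM0, hM⟩ := exists_abs_le s
  set N := toMeasurable σ {x | ¬ |s x| ≤ c} with hN
  have hNm : MeasurableSet N := measurableSet_toMeasurable _ _
  have hN0 : μ.variationReal N = 0 := by
    rw [variationReal, μ.totalVariation_eq_zero_of_null, ENNReal.toReal_zero]
    rw [hN, measure_toMeasurable]
    exact h
  have := SimpleFunc.setSum_mono (fun _ _ => μ.variationReal_union) μ.variationReal_nonneg
    (s := s.map abs) (t := SimpleFunc.const α c +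
      SimpleFunc.piecewise N hNm (SimpleFunc.const α M) (SimpleFunc.const α 0)) fun x => by
    simp only [SimpleFunc.map_apply, SimpleFunc.add_apply, SimpleFunc.const_apply,
      SimpleFunc.piecewise_apply]
    split_ifs with hx
    · linarith [hM x]
    · have : x ∉ {x | ¬ |s x| ≤ c} := fun h' => hx (subset_toMeasurable _ _ h')
      simpa using this
  rwa [SimpleFunc.setSum_add (fun _ _ => μ.variationReal_union),
    SimpleFunc.setSum_const _ μ.variationReal_empty,
    SimpleFunc.setSum_piecewise_const (fun _ _ => μ.variationReal_union), hN0, mul_zero,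
    add_zero] at this

theorem exists_measurableSet_of_tendstoInVariation {s : ℕ → SimpleFunc α ℝ} {f : α → ℝ}
    (h : μ.TendstoInVariation s f) {η ε : ℝ} (hη : 0 < η) (hε : 0 < ε) :
    ∀ᶠ k in atTop, ∃ B, MeasurableSet B ∧ (∀ x ∉ B, |s k x - f x| ≤ η) ∧
      μ.variationReal B ≤ ε := by
  filter_upwards [(h η hη).eventually_lt_const (ENNReal.ofReal_pos.2 hε)] with k hk
  obtain ⟨B, ⟨hB, hsub⟩, hlt⟩ := by simpa only [outerVariation, iInf_lt_iff, exists_prop] using hk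
  refine ⟨B, hB, fun x hx => not_lt.1 fun h' => hx (hsub h'), ?_⟩
  exact ENNReal.toReal_le_of_le_ofReal hε.le hlt.le

theorem eventually_setSum_sub_le {s : ℕ → SimpleFunc α ℝ}
    (h : Tendsto (fun p : ℕ × ℕ => μ.simpleNorm (s p.1 - s p.2)) atTop (𝓝 0))
    {ε : ℝ} (hε : 0 < ε) :
    ∃ N, ∀ k ≥ N, ∀ l ≥ N, ((s k - s l).map abs).setSum μ.variationReal ≤ ε := by
  obtain ⟨⟨a, b⟩, hab⟩ := eventually_atTop.1
    (h.eventually_lt_const (ENNReal.ofReal_pos.2 hε))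
  refine ⟨max a b, fun k hk l hl => ?_⟩
  have := hab (k, l) ⟨(le_max_left a b).trans hk, (le_max_right a b).trans hl⟩
  rw [simpleNorm_eq] at this
  exact ((ENNReal.ofReal_lt_ofReal_iff hε).1 this).le

/-- The integral does not depend on the determining sequence. -/
theorem HasIntegral.unique {μ : BddAddMeasure σ ℝ} {f : α → ℝ} {I J : ℝ}
    (hI : μ.HasIntegral f I) (hJ : μ.HasIntegral f J) : I = J := by
  obtain ⟨s, hs, hsc, hsI⟩ := hI
  obtain ⟨t, ht, htc, htJ⟩ := hJ
  set v := μ.variationReal univ with hv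
  have hv0 : 0 ≤ v := μ.variationReal_nonneg _
  have hadd : ∀ A B, MeasurableSet A → MeasurableSet B → Disjoint A B →
    μ.variationReal (A ∪ B) = μ.variationReal A + μ.variationReal B :=
    fun _ _ => μ.variationReal_union
  -- The term `2v` comes from the set where `s k` and `t k` are both within `ε` of `f`. The four
  -- remaining `ε` are the two Cauchy tails and the two exceptional sets.
  suffices h : ∀ ε > 0, |I - J| ≤ ε * (2 * v + 4) by
    by_contra hne
    have hpos : 0 < |I - J| := abs_pos.2 (sub_ne_zero.2 hne)
    have := h (|I - J| / (2 * (2 * v + 4))) (by positivity)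
    rw [div_mul_eq_mul_div, div_eq_mul_inv] at this
    have h4 : (2 * v + 4) * (2 * (2 * v + 4))⁻¹ = 2⁻¹ := by field_simp
    rw [mul_assoc, h4] at this
    linarith
  intro ε hε
  obtain ⟨N₁, hN₁⟩ := μ.eventually_setSum_sub_le hsc hε
  obtain ⟨N₂, hN₂⟩ := μ.eventually_setSum_sub_le htc hε
  set N := max N₁ N₂
  -- The bound `M` belongs to the fixed index `N`, so it precedes the choice of the exceptional sets
  -- for `k`, whose variation can then be made at most `ε / (M + 1)`. On those sets `s k - t k` is
  -- compared with `s N - t N`.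
  obtain ⟨M, hM0, hM⟩ := exists_abs_le (s N - t N)
  refine le_of_tendsto (hsI.sub htJ).abs ?_
  have hε' : 0 < ε / (M + 1) := by positivity
  filter_upwards [μ.exists_measurableSet_of_tendstoInVariation hs hε hε',
    μ.exists_measurableSet_of_tendstoInVariation ht hε hε', eventually_ge_atTop N]
    with k ⟨B, hB, hBs, hBv⟩ ⟨D, hD, hDs, hDv⟩ hk
  rw [← simpleIntegral_sub]
  refine (μ.abs_simpleIntegral_le _).trans ?_
  have hmono := SimpleFunc.setSum_mono hadd μ.variationReal_nonneg
    (s := (s k - t k).map abs)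
    (t := SimpleFunc.const α (2 * ε) + ((s k - s N).map abs + (t k - t N).map abs) +
      (SimpleFunc.piecewise B hB (SimpleFunc.const α M) (SimpleFunc.const α 0) +
      SimpleFunc.piecewise D hD (SimpleFunc.const α M) (SimpleFunc.const α 0))) fun x => by
    simp only [SimpleFunc.map_apply, SimpleFunc.add_apply, SimpleFunc.const_apply,
      SimpleFunc.piecewise_apply, SimpleFunc.sub_apply]
    have h1 := hM x
    simp only [SimpleFunc.sub_apply] at h1
    have h2 : |s k x - t k x| ≤ |s k x - s N x| + |t k x - t N x| + |s N x - t N x| := by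
      have e : s k x - t k x = (s k x - s N x) - (t k x - t N x) + (s N x - t N x) := by ring
      rw [e]
      exact (abs_add_le _ _).trans (by gcongr; exact abs_sub _ _)
    by_cases hxB : x ∈ B
    · split_ifs <;> linarith
    by_cases hxD : x ∈ D
    · split_ifs; linarith
    · have h3 := hBs x hxB
      have h4 := hDs x hxD
      have h5 : |s k x - t k x| ≤ |s k x - f x| + |t k x - f x| := by
        have e : s k x - t k x = (s k x - f x) - (t k x - f x) := by ring
        rw [e]
        exact abs_sub _ _
      have := abs_nonneg (s k x - s N x)
      have := abs_nonneg (t k x - t N x)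
      split_ifs
      linarith
  rw [SimpleFunc.setSum_add hadd, SimpleFunc.setSum_add hadd, SimpleFunc.setSum_add hadd,
    SimpleFunc.setSum_add hadd, SimpleFunc.setSum_const _ μ.variationReal_empty,
    SimpleFunc.setSum_piecewise_const hadd, SimpleFunc.setSum_piecewise_const hadd, ← hv] at hmono
  have a1 := hN₁ k ((le_max_left _ _).trans hk) N (le_max_left _ _)
  have a2 := hN₂ k ((le_max_right _ _).trans hk) N (le_max_right _ _)
  have key : ∀ r, r ≤ ε / (M + 1) → M * r ≤ ε := fun r hr => by
    calc M * r ≤ M * (ε / (M + 1)) := by gcongr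
      _ ≤ (M + 1) * (ε / (M + 1)) := by gcongr; linarith
      _ = ε := by field_simp
  have a3 := key _ hBv
  have a4 := key _ hDv
  linarith

theorem HasIntegral.integral_eq {μ : BddAddMeasure σ ℝ} {f : α → ℝ} {I : ℝ}
    (hI : μ.HasIntegral f I) : μ.integral f = I := by
  have h : ∃ I, μ.HasIntegral f I := ⟨I, hI⟩
  rw [integral, dif_pos h]
  exact h.choose_spec.unique hI

theorem outerVariation_le_of_subset_union {A B N : Set α} (hN : MeasurableSet N)
    (hN0 : μ.totalVariation N = 0) (h : A ⊆ B ∪ N) :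
    μ.outerVariation A ≤ μ.outerVariation B := by
  refine le_iInf₂ fun D ⟨hD, hBD⟩ => ?_
  refine (iInf₂_le (D ∪ N) ⟨hD.union hN, h.trans (union_subset_union_left N hBD)⟩).trans ?_
  simpa [hN0] using μ.totalVariation_union_le hD hN

theorem HasIntegral.congr {μ : BddAddMeasure σ ℝ} {f g : α → ℝ} {N : Set α}
    (hN : MeasurableSet N) (hN0 : μ.totalVariation N = 0) (h : ∀ x ∉ N, f x = g x) {I : ℝ}
    (hI : μ.HasIntegral f I) : μ.HasIntegral g I := by
  obtain ⟨s, hs, hsc, hsI⟩ := hI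
  refine ⟨s, fun ε hε => ?_, hsc, hsI⟩
  refine tendsto_of_tendsto_of_tendsto_of_le_of_le tendsto_const_nhds (hs ε hε)
    (fun _ => zero_le) fun k => ?_
  refine μ.outerVariation_le_of_subset_union hN hN0 fun x hx => ?_
  by_cases hxN : x ∈ N
  · exact Or.inr hxN
  · left
    simpa [h x hxN] using hx

theorem integral_congr {f g : α → ℝ} {N : Set α}
    (hN : MeasurableSet N) (hN0 : μ.totalVariation N = 0) (h : ∀ x ∉ N, f x = g x) :
    μ.integral f = μ.integral g := by
  have hiff : ∀ I, μ.HasIntegral f I ↔ μ.HasIntegral g I := fun I =>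
    ⟨fun hI => hI.congr hN hN0 h, fun hI => hI.congr hN hN0 fun x hx => (h x hx).symm⟩
  by_cases hf : ∃ I, μ.HasIntegral f I
  · obtain ⟨I, hI⟩ := hf
    rw [hI.integral_eq, ((hiff I).1 hI).integral_eq]
  · rw [integral, integral, dif_neg hf, dif_neg fun ⟨I, hI⟩ => hf ⟨I, (hiff I).2 hI⟩]

/-- Uniform approximation of an essentially bounded function by simple functions. -/
theorem _root_.MeasureTheory.exists_simpleFunc_ae_abs_sub_le {f : α → ℝ}
    (hf : AEStronglyMeasurable f σ) {c : ℝ} (hc : ∀ᵐ x ∂σ, |f x| ≤ c) {ε : ℝ} (hε : 0 < ε) :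
    ∃ s : SimpleFunc α ℝ, ∀ᵐ x ∂σ, |s x - f x| ≤ ε := by
  set g : α → ℝ := fun x => max (-c) (min c (hf.mk f x)) with hg
  have hgm : Measurable g :=
    measurable_const.max (measurable_const.min hf.stronglyMeasurable_mk.measurable)
  have hfl : Measurable fun x => ⌊g x / ε⌋ := Int.measurable_floor.comp (hgm.div_const ε)
  -- Rounding down to multiples of `ε`; the truncation in `g` makes the range finite.
  refine ⟨⟨fun x => ε * ⌊g x / ε⌋, fun y => ?_, ?_⟩, ?_⟩
  · exact (measurable_const.mul (measurable_from_top.comp hfl)) (measurableSet_singleton y)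
  · refine ((Set.finite_Icc ⌊(-c) / ε⌋ ⌊max (-c) c / ε⌋).image fun k : ℤ => ε * (k : ℝ)).subset ?_
    rintro _ ⟨x, rfl⟩
    refine ⟨⌊g x / ε⌋, ⟨Int.floor_mono ?_, Int.floor_mono ?_⟩, rfl⟩
    · gcongr
      exact le_max_left _ _
    · gcongr
      exact max_le_max le_rfl (min_le_left _ _)
  · filter_upwards [hc, hf.ae_eq_mk] with x hx hfx
    have hgx : g x = f x := by
      rw [abs_le] at hx
      simp only [hg, ← hfx]
      rw [min_eq_right hx.2, max_eq_right hx.1]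
    change |ε * (⌊g x / ε⌋ : ℝ) - f x| ≤ ε
    rw [hgx]
    have h1 := Int.floor_le (f x / ε)
    have h2 := Int.lt_floor_add_one (f x / ε)
    rw [le_div_iff₀ hε] at h1
    rw [div_lt_iff₀ hε] at h2
    rw [abs_le]
    constructor <;> nlinarith

/-- A sequence of simple functions that converges uniformly, up to null sets, is determining. -/
theorem hasIntegral_of_ae_abs_sub_le {f : α → ℝ} {s : ℕ → SimpleFunc α ℝ} {e : ℕ → ℝ}
    (he : Tendsto e atTop (𝓝 0)) (hs : ∀ k, ∀ᵐ x ∂σ, |s k x - f x| ≤ e k) {I : ℝ}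
    (hI : Tendsto (fun k => μ.simpleIntegral (s k)) atTop (𝓝 I)) : μ.HasIntegral f I := by
  refine ⟨s, fun ε hε => ?_, ?_, hI⟩
  · refine tendsto_const_nhds.congr' ?_
    filter_upwards [he.eventually_le_const hε] with k hk
    refine (nonpos_iff_eq_zero.1 ?_).symm
    refine (iInf₂_le (toMeasurable σ {x | ε < |s k x - f x|})
      ⟨measurableSet_toMeasurable _ _, subset_toMeasurable _ _⟩).trans ?_
    rw [μ.totalVariation_eq_zero_of_null]
    rw [measure_toMeasurable]
    refine measure_mono_null (fun x hx => ?_) (hs k)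
    exact not_le.2 (hk.trans_lt hx)
  · simp only [simpleNorm_eq]
    rw [← ENNReal.ofReal_zero]
    refine (ENNReal.continuous_ofReal.tendsto 0).comp ?_
    have hlim : Tendsto (fun p : ℕ × ℕ => (|e p.1| + |e p.2|) * μ.variationReal univ) atTop
        (𝓝 0) := by
      have h1 : Tendsto (fun p : ℕ × ℕ => |e p.1|) atTop (𝓝 0) := by
        rw [← prod_atTop_atTop_eq]
        simpa using (he.comp tendsto_fst).abs
      have h2 : Tendsto (fun p : ℕ × ℕ => |e p.2|) atTop (𝓝 0) := by
        rw [← prod_atTop_atTop_eq]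
        simpa using (he.comp tendsto_snd).abs
      simpa using (h1.add h2).mul_const (μ.variationReal univ)
    refine tendsto_of_tendsto_of_tendsto_of_le_of_le tendsto_const_nhds hlim
      (fun p => SimpleFunc.setSum_nonneg μ.variationReal_nonneg fun x => abs_nonneg _) fun p => ?_
    refine μ.setSum_abs_le_of_ae _ (by positivity) ?_
    filter_upwards [hs p.1, hs p.2] with x h1 h2
    have e1 : (s p.1 - s p.2) x = (s p.1 x - f x) - (s p.2 x - f x) := by
      simp
    rw [e1]
    exact (abs_sub _ _).trans (add_le_add (h1.trans (le_abs_self _)) (h2.trans (le_abs_self _)))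

/-- Simple functions within `1 / (k + 1)` of `f` have Cauchy integrals because the variation is
finite. Thus the integral exists, and the bound passes to the limit. -/
theorem abs_integral_le {f : α → ℝ} (hf : AEStronglyMeasurable f σ) {c : ℝ} (hc0 : 0 ≤ c)
    (hc : ∀ᵐ x ∂σ, |f x| ≤ c) : |μ.integral f| ≤ c * μ.variationReal univ := by
  choose s hs using fun k : ℕ => exists_simpleFunc_ae_abs_sub_le hf hc (ε := 1 / ((k : ℝ) + 1))
    (by positivity)
  have he := tendsto_one_div_add_atTop_nhds_zero_nat (𝕜 := ℝ)
  have hbound : ∀ k l, |μ.simpleIntegral (s k) - μ.simpleIntegral (s l)| ≤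
      (1 / ((k : ℝ) + 1) + 1 / ((l : ℝ) + 1)) * μ.variationReal univ := by
    intro k l
    rw [← simpleIntegral_sub]
    refine (μ.abs_simpleIntegral_le _).trans (μ.setSum_abs_le_of_ae _ (by positivity) ?_)
    filter_upwards [hs k, hs l] with x h1 h2
    have e1 : (s k - s l) x = (s k x - f x) - (s l x - f x) := by
      simp
    rw [e1]
    exact (abs_sub _ _).trans (add_le_add h1 h2)
  have hcau : CauchySeq fun k => μ.simpleIntegral (s k) := by
    refine cauchySeq_of_le_tendsto_0 (fun N : ℕ => (1 / ((N : ℝ) + 1) + 1 / ((N : ℝ) + 1)) *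
      μ.variationReal univ) (fun k l N hk hl => (hbound k l).trans ?_) ?_
    · have := μ.variationReal_nonneg univ
      gcongr
    · simpa using (he.add he).mul_const (μ.variationReal univ)
  obtain ⟨I, hI⟩ := cauchySeq_tendsto_of_complete hcau
  rw [(μ.hasIntegral_of_ae_abs_sub_le he hs hI).integral_eq]
  refine le_of_tendsto_of_tendsto hI.abs (b := atTop)
    (g := fun k : ℕ => (c + 1 / ((k : ℝ) + 1)) * μ.variationReal univ) ?_ ?_
  · simpa using (tendsto_const_nhds (x := c)).add he |>.mul_const (μ.variationReal univ)
  · refine Eventually.of_forall fun k => ?_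
    refine (μ.abs_simpleIntegral_le _).trans (μ.setSum_abs_le_of_ae _ (by positivity) ?_)
    filter_upwards [hs k, hc] with x h1 h2
    have : s k x = f x + (s k x - f x) := by ring
    rw [this]
    exact (abs_add_le _ _).trans (add_le_add h2 h1)

end BddAddMeasure

/-! ### Integrals with respect to signed measures with a density -/

section SignedMeasure

variable {X : Type*} [MeasurableSpace X]

theorem vectorMeasure_integral_toSignedMeasure (μ : Measure X) [IsFiniteMeasure μ] (f : X → ℝ) :
    μ.toSignedMeasure.integral f (.lsmul ℝ ℝ) = ∫ x, f x ∂μ := by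
  have h : (ContinuousLinearMap.lsmul ℝ ℝ : ℝ →L[ℝ] ℝ →L[ℝ] ℝ) =
      (ContinuousLinearMap.lsmul ℝ ℝ : ℝ →L[ℝ] ℝ →L[ℝ] ℝ).flip := by
    ext
    simp
  rw [h]
  exact VectorMeasure.integral_toSignedMeasure

theorem integrable_variation_toSignedMeasure {μ : Measure X} [IsFiniteMeasure μ] {f : X → ℝ}
    (hf : Integrable f μ) : μ.toSignedMeasure.Integrable f := by
  rw [VectorMeasure.Integrable, Measure.variation_toSignedMeasure]
  exact hf

theorem vectorMeasure_integral_withDensityᵥ (μ : Measure X) {h : X → ℝ} (hh : Integrable h μ)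
    {f : X → ℝ} (hf : Measurable f) {C : ℝ} (hC : ∀ x, |f x| ≤ C) :
    (μ.withDensityᵥ h).integral f (.lsmul ℝ ℝ) = ∫ x, f x * h x ∂μ := by
  have hp := isFiniteMeasure_withDensity_ofReal hh.2
  have hn := isFiniteMeasure_withDensity_ofReal hh.neg.2
  have hb : ∀ (ν : Measure X) [IsFiniteMeasure ν], Integrable f ν := fun ν _ =>
    Integrable.of_bound hf.aestronglyMeasurable C (Eventually.of_forall hC)
  have key : ∀ g : X → ℝ, Integrable g μ →
      ∫ x, f x ∂(μ.withDensity fun x => ENNReal.ofReal (g x)) = ∫ x, f x * max (g x) 0 ∂μ := by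
    intro g hg
    rw [integral_withDensity_eq_integral_toReal_smul₀ hg.aemeasurable.ennreal_ofReal
      (Eventually.of_forall fun _ => ENNReal.ofReal_lt_top)]
    refine integral_congr_ae (Eventually.of_forall fun x => ?_)
    simp [ENNReal.toReal_ofReal', mul_comm]
  have hint : ∀ g : X → ℝ, Integrable g μ → Integrable (fun x => f x * max (g x) 0) μ :=
    fun g hg => hg.pos_part.bdd_mul hf.aestronglyMeasurable (Eventually.of_forall hC)
  rw [withDensityᵥ_eq_withDensity_pos_part_sub_withDensity_neg_part hh,
    VectorMeasure.integral_sub_vectorMeasure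
      (integrable_variation_toSignedMeasure (hb _)) (integrable_variation_toSignedMeasure (hb _)),
    vectorMeasure_integral_toSignedMeasure, vectorMeasure_integral_toSignedMeasure,
    key h hh, key (fun x => -h x) hh.neg, ← integral_sub (hint h hh) (hint (fun x => -h x) hh.neg)]
  refine integral_congr_ae (Eventually.of_forall fun x => ?_)
  simp only
  rw [← mul_sub, max_zero_sub_max_neg_zero_eq_self]

/-- The Radon-Nikodym density of `ν` with respect to its own variation. It turns statements about
signed measures into almost everywhere statements about a function. -/
theorem exists_eq_withDensityᵥ (ν : SignedMeasure X) :
    ∃ (μ : Measure X) (h : X → ℝ), IsFiniteMeasure μ ∧ Integrable h μ ∧ ν = μ.withDensityᵥ h := by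
  refine ⟨ν.totalVariation, ν.rnDeriv ν.totalVariation, inferInstance,
    SignedMeasure.integrable_rnDeriv _ _, ?_⟩
  refine (SignedMeasure.withDensityᵥ_rnDeriv_eq ν _ ?_).symm
  rw [SignedMeasure.absolutelyContinuous_ennreal_iff,
    VectorMeasure.ennrealToMeasure_toENNRealVectorMeasure]

theorem isFiniteMeasure_variation (ν : SignedMeasure X) : IsFiniteMeasure ν.variation := by
  rw [← SignedMeasure.totalVariation_eq_variation]
  infer_instance

theorem integrable_variation_of_bounded (ν : SignedMeasure X) {f : X → ℝ} (hf : Measurable f)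
    {C : ℝ} (hC : ∀ x, |f x| ≤ C) : ν.Integrable f :=
  haveI := isFiniteMeasure_variation ν
  Integrable.of_bound (μ := ν.variation) hf.aestronglyMeasurable C (Eventually.of_forall hC)

end SignedMeasure

/-! ### Test functions and uniqueness of the divergence -/

section Divergence

variable {n : ℕ} {U : Set (EuclideanSpace ℝ (Fin n))}
  {F G : EuclideanSpace ℝ (Fin n) → EuclideanSpace ℝ (Fin n)}

theorem continuous_gradient {f : EuclideanSpace ℝ (Fin n) → ℝ} (hf : ContDiff ℝ 1 f) :
    Continuous (gradient f) :=
  (InnerProductSpace.toDual ℝ _).symm.continuous.comp (hf.continuous_fderiv one_ne_zero)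

theorem gradient_eq_zero_of_notMem_tsupport {f : EuclideanSpace ℝ (Fin n) → ℝ}
    {x : EuclideanSpace ℝ (Fin n)} (hx : x ∉ tsupport f) : gradient f x = 0 := by
  have : fderiv ℝ f x = 0 := by
    by_contra h
    exact hx (tsupport_fderiv_subset ℝ (subset_tsupport _ h))
  simp [gradient, this]

theorem gradient_eq_of_eventuallyEq {f g : EuclideanSpace ℝ (Fin n) → ℝ}
    {x : EuclideanSpace ℝ (Fin n)} (h : f =ᶠ[𝓝 x] g) : gradient f x = gradient g x := by
  simp [gradient, h.fderiv_eq]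

namespace IsTestFunction

variable {ψ : EuclideanSpace ℝ (Fin n) → ℝ}

theorem continuous (hψ : IsTestFunction U ψ) : Continuous ψ := hψ.1.continuous

theorem continuous_gradient (hψ : IsTestFunction U ψ) : Continuous (gradient ψ) :=
  _root_.continuous_gradient (hψ.1.of_le (by simp))

theorem mono {W : Set (EuclideanSpace ℝ (Fin n))} (hψ : IsTestFunction U ψ) (h : U ⊆ W) :
    IsTestFunction W ψ := ⟨hψ.1, hψ.2.1, hψ.2.2.trans h⟩

theorem exists_abs_le (hψ : IsTestFunction U ψ) : ∃ C, ∀ x, |ψ x| ≤ C :=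
  hψ.2.1.exists_bound_of_continuous hψ.continuous

theorem hasCompactSupport_gradient (hψ : IsTestFunction U ψ) : HasCompactSupport (gradient ψ) :=
  HasCompactSupport.intro hψ.2.1 fun _ hx => gradient_eq_zero_of_notMem_tsupport hx

theorem exists_norm_gradient_le (hψ : IsTestFunction U ψ) : ∃ C, ∀ x, ‖gradient ψ x‖ ≤ C :=
  hψ.hasCompactSupport_gradient.exists_bound_of_continuous hψ.continuous_gradient

theorem integrable_variation (hψ : IsTestFunction U ψ)
    (ν : SignedMeasure (EuclideanSpace ℝ (Fin n))) : ν.Integrable ψ :=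
  integrable_variation_of_bounded ν hψ.continuous.measurable hψ.exists_abs_le.choose_spec

theorem integrable_inner_gradient (hψ : IsTestFunction U ψ) (hF : MemLp F 1 (volume.restrict U)) :
    Integrable (fun x => inner ℝ (F x) (gradient ψ x)) (volume.restrict U) := by
  obtain ⟨C, hC⟩ := hψ.exists_norm_gradient_le
  have hFi := memLp_one_iff_integrable.1 hF
  refine (hFi.norm.const_mul C).mono'
    (hFi.aestronglyMeasurable.inner hψ.continuous_gradient.aestronglyMeasurable)
    (Eventually.of_forall fun x => ?_)
  refine (norm_inner_le_norm _ _).trans ?_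
  rw [mul_comm]
  gcongr
  exact hC x

theorem integral_withDensityᵥ (hψ : IsTestFunction U ψ)
    (μ : Measure (EuclideanSpace ℝ (Fin n))) {h : EuclideanSpace ℝ (Fin n) → ℝ}
    (hh : Integrable h μ) :
    (μ.withDensityᵥ h).integral ψ (.lsmul ℝ ℝ) = ∫ x, ψ x * h x ∂μ :=
  vectorMeasure_integral_withDensityᵥ μ hh hψ.continuous.measurable hψ.exists_abs_le.choose_spec

end IsTestFunction

/-- A density all of whose integrals against test functions vanish is zero. -/
theorem ae_eq_zero_of_integral_testFunction (hU : IsOpen U)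
    {μ : Measure (EuclideanSpace ℝ (Fin n))}
    {h : EuclideanSpace ℝ (Fin n) → ℝ} (hh : Integrable h μ)
    (H : ∀ ψ, IsTestFunction U ψ → (μ.withDensityᵥ h).integral ψ (.lsmul ℝ ℝ) = 0) :
    ∀ᵐ x ∂μ, x ∈ U → h x = 0 := by
  refine hU.ae_eq_zero_of_integral_contDiff_smul_eq_zero (hh.locallyIntegrable.locallyIntegrableOn U)
    fun ψ h1 h2 h3 => ?_
  have hψ : IsTestFunction U ψ := ⟨h1, h2, h3⟩
  rw [← H ψ hψ, hψ.integral_withDensityᵥ μ hh]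
  rfl

theorem signedMeasure_apply_eq_zero (hU : IsOpen U)
    {ν : SignedMeasure (EuclideanSpace ℝ (Fin n))}
    (H : ∀ ψ, IsTestFunction U ψ → ν.integral ψ (.lsmul ℝ ℝ) = 0)
    {A : Set (EuclideanSpace ℝ (Fin n))} (hA : MeasurableSet A) (hAU : A ⊆ U) : ν A = 0 := by
  obtain ⟨μ, h, _, hh, rfl⟩ := exists_eq_withDensityᵥ ν
  rw [withDensityᵥ_apply hh hA]
  refine integral_eq_zero_of_ae ((ae_restrict_iff' hA).2 ?_)
  filter_upwards [ae_eq_zero_of_integral_testFunction hU hh H] with x hx hxA using hx (hAU hxA)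

namespace IsDivMeasure

variable {ν ν' : SignedMeasure (EuclideanSpace ℝ (Fin n))}

/-- Test functions determine the measure inside `U`; the requirement `ν.restrict U = ν` settles the
rest of the space. -/
theorem unique (hU : IsOpen U) (h : IsDivMeasure U F ν) (h' : IsDivMeasure U F ν') : ν = ν' := by
  have key : ∀ A, MeasurableSet A → A ⊆ U → (ν - ν') A = 0 := fun A hA hAU => by
    refine signedMeasure_apply_eq_zero hU (fun ψ hψ => ?_) hA hAU
    rw [VectorMeasure.integral_sub_vectorMeasure (hψ.integrable_variation _)
      (hψ.integrable_variation _), sub_eq_zero]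
    have := (h.2 ψ hψ).symm.trans (h'.2 ψ hψ)
    exact neg_injective this
  ext A hA
  rw [← h.1, ← h'.1, VectorMeasure.restrict_apply _ hU.measurableSet hA,
    VectorMeasure.restrict_apply _ hU.measurableSet hA]
  exact sub_eq_zero.1 (key _ (hA.inter hU.measurableSet) inter_subset_right)

theorem divMeasure_eq (hU : IsOpen U) (h : IsDivMeasure U F ν) : divMeasure U F = ν := by
  have hex : ∃ ν, IsDivMeasure U F ν := ⟨ν, h⟩
  rw [divMeasure, dif_pos hex]
  exact hex.choose_spec.unique hU h

theorem add (hF : MemLp F 1 (volume.restrict U)) (hG : MemLp G 1 (volume.restrict U))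
    (h : IsDivMeasure U F ν) (h' : IsDivMeasure U G ν') :
    IsDivMeasure U (fun x => F x + G x) (ν + ν') := by
  refine ⟨by rw [VectorMeasure.restrict_add, h.1, h'.1], fun ψ hψ => ?_⟩
  rw [VectorMeasure.integral_add_vectorMeasure (hψ.integrable_variation _)
    (hψ.integrable_variation _), neg_add, ← h.2 ψ hψ, ← h'.2 ψ hψ, ← integral_add
    (hψ.integrable_inner_gradient hF) (hψ.integrable_inner_gradient hG)]
  simp only [inner_add_left]

theorem smul (c : ℝ) (h : IsDivMeasure U F ν) : IsDivMeasure U (fun x => c • F x) (c • ν) := by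
  refine ⟨by rw [VectorMeasure.restrict_smul, h.1], fun ψ hψ => ?_⟩
  rw [VectorMeasure.integral_smul_vectorMeasure, smul_eq_mul, ← mul_neg, ← h.2 ψ hψ,
    ← integral_const_mul]
  simp only [inner_smul_left, RCLike.conj_to_real]

/-- If a field with divergence measure vanishes near `∂Ω`, its divergence does not charge `Ω`. -/
theorem apply_eq_zero (hU : IsOpen U) (hUb : Bornology.IsBounded U)
    {Ω : Set (EuclideanSpace ℝ (Fin n))} (hΩ : MeasurableSet Ω) (hΩU : Ω ⊆ U)
    {δ : ℝ} (hδ : 0 < δ) (h : IsDivMeasure U G ν)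
    (hG : ∀ᵐ x ∂volume.restrict U, x ∈ Metric.thickening δ (frontier Ω) → G x = 0) :
    ν Ω = 0 := by
  obtain ⟨μ, d, _, hd, rfl⟩ := exists_eq_withDensityᵥ ν
  set T := Metric.thickening δ (frontier Ω) with hT
  have hTo : IsOpen T := Metric.isOpen_thickening
  have hsub : frontier Ω ⊆ T := Metric.self_subset_thickening hδ _
  have hd0 : ∀ᵐ x ∂μ, x ∈ U ∩ T → d x = 0 := by
    refine ae_eq_zero_of_integral_testFunction (hU.inter hTo) hd fun ψ hψ => ?_
    rw [← neg_eq_zero, ← h.2 ψ (hψ.mono inter_subset_left)]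
    refine integral_eq_zero_of_ae ?_
    filter_upwards [hG] with x hx
    by_cases hxT : x ∈ T
    · simp [hx hxT]
    · rw [gradient_eq_zero_of_notMem_tsupport fun hx' => hxT (hψ.2.2 hx').2]
      simp
  have hcl : ∀ x, x ∈ closure Ω → x ∉ T → x ∈ interior Ω := fun x hx hxT => by
    by_contra hi
    exact hxT (hsub ⟨hx, hi⟩)
  have hKi : closure Ω \ T ⊆ interior (interior Ω) := by
    rw [interior_interior]
    exact fun x hx => hcl x hx.1 hx.2
  have hKc : IsCompact (closure Ω \ T) :=
    (hUb.subset hΩU).isCompact_closure.diff hTo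
  obtain ⟨L, hL, hKL, hLi⟩ := exists_compact_between hKc isOpen_interior
    (by rwa [interior_interior] at hKi)
  -- The points of the closure of `Ω` off `T` form a compact subset of the interior of `Ω`; `η` is
  -- one near this set and is supported in the interior.
  obtain ⟨η, hη1, hη0, -⟩ := exists_contMDiffMap_one_nhds_of_subset_interior
    (n := ⊤) (modelWithCornersSelf ℝ (EuclideanSpace ℝ (Fin n))) hKc.isClosed hKL
  have hηs : tsupport η ⊆ L := closure_minimal (fun x hx => by
    by_contra hxL
    exact hx (hη0 x hxL)) hL.isClosed
  have hηt : IsTestFunction U η :=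
    ⟨η.contMDiff.contDiff, hL.of_isClosed_subset (isClosed_tsupport _) hηs,
      (hηs.trans hLi).trans (interior_subset.trans hΩU)⟩
  -- The product `G · ∇η` vanishes almost everywhere: `G` is zero on `T`, and off `T` the cutoff is
  -- locally constant, equal to one near points of the closure of `Ω` and to zero near the others.
  have h1 : ∫ x, η x * d x ∂μ = 0 := by
    rw [← hηt.integral_withDensityᵥ μ hd, ← neg_eq_zero, ← h.2 η hηt]
    refine integral_eq_zero_of_ae ?_
    filter_upwards [hG] with x hx
    by_cases hxT : x ∈ T
    · simp [hx hxT]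
    · by_cases hxc : x ∈ closure Ω
      · have : (η : EuclideanSpace ℝ (Fin n) → ℝ) =ᶠ[𝓝 x] fun _ => 1 :=
          eventually_nhdsSet_iff_forall.1 hη1 x ⟨hxc, hxT⟩
        rw [gradient_eq_of_eventuallyEq this]
        simp [gradient]
      · rw [gradient_eq_zero_of_notMem_tsupport fun hx' =>
          hxc (subset_closure (interior_subset (hLi (hηs hx'))))]
        simp
  have hdU : ∀ᵐ x ∂μ, x ∉ U → d x = 0 := by
    have hr : (μ.withDensityᵥ (Uᶜ.indicator d)) = μ.withDensityᵥ 0 := by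
      ext A hA
      rw [withDensityᵥ_apply (hd.indicator hU.measurableSet.compl) hA, withDensityᵥ_zero]
      rw [setIntegral_indicator hU.measurableSet.compl,
        ← withDensityᵥ_apply hd (hA.inter hU.measurableSet.compl), ← h.1,
        VectorMeasure.restrict_apply _ hU.measurableSet (hA.inter hU.measurableSet.compl)]
      simp [inter_assoc]
    have := Integrable.ae_eq_of_withDensityᵥ_eq (hd.indicator hU.measurableSet.compl)
      (integrable_zero _ _ _) hr
    filter_upwards [this] with x hx hxU
    simpa [hxU] using hx
  -- Almost everywhere `1_Ω d = η d`: on `Ω ∩ T` the density is zero, on `Ω \ T` the cutoff is one,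
  -- and outside `Ω` it is zero.
  rw [withDensityᵥ_apply hd hΩ, ← h1, ← integral_indicator hΩ]
  refine integral_congr_ae ?_
  filter_upwards [hd0, hdU] with x hx hxU
  by_cases hxΩ : x ∈ Ω
  · rw [indicator_of_mem hxΩ]
    by_cases hxT : x ∈ T
    · rw [hx ⟨hΩU hxΩ, hxT⟩, mul_zero]
    · rw [(eventually_nhdsSet_iff_forall.1 hη1 x ⟨subset_closure hxΩ, hxT⟩).self_of_nhds, one_mul]
  · rw [indicator_of_notMem hxΩ]
    rw [hη0 x fun hxL => hxΩ (interior_subset (hLi hxL)), zero_mul]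

end IsDivMeasure

end Divergence

/-! ### Mollification -/

section Mollification

open scoped Convolution
open ContinuousLinearMap (lsmul)

/-- A bounded representative which vanishes off `U`. -/
theorem MeasureTheory.MemLp.exists_bounded_representative {X V : Type*} [MeasurableSpace X]
    [NormedAddCommGroup V] {σ : Measure X} {U : Set X} (hU : MeasurableSet U) {f : X → V}
    (hf : MemLp f ∞ (σ.restrict U)) :
    ∃ (g : X → V) (C : ℝ), StronglyMeasurable g ∧ (∀ x, ‖g x‖ ≤ C) ∧ (∀ x ∉ U, g x = 0) ∧
      g =ᵐ[σ.restrict U] f ∧ 0 ≤ C := by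
  obtain ⟨C, hC0, hC⟩ : ∃ C : ℝ, 0 ≤ C ∧ ∀ᵐ x ∂σ.restrict U, ‖f x‖ ≤ C := by
    refine ⟨(eLpNormEssSup f (σ.restrict U)).toReal, ENNReal.toReal_nonneg, ?_⟩
    have htop : eLpNormEssSup f (σ.restrict U) ≠ ⊤ := by
      simpa using hf.2.ne
    filter_upwards [enorm_ae_le_eLpNormEssSup f (σ.restrict U)] with x hx
    simpa using ENNReal.toReal_mono htop hx
  set m := hf.1.mk f with hm
  have hmm : StronglyMeasurable m := hf.1.stronglyMeasurable_mk
  set S := U ∩ {x | ‖m x‖ ≤ C} with hS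
  have hSm : MeasurableSet S :=
    hU.inter (measurableSet_le hmm.norm.measurable measurable_const)
  refine ⟨S.indicator m, C, hmm.indicator hSm, fun x => ?_, fun x hx => ?_, ?_, hC0⟩
  · by_cases hx : x ∈ S
    · simpa [hx] using hx.2
    · simpa [hx] using hC0
  · exact indicator_of_notMem (fun h => hx h.1) _
  · filter_upwards [hC, hf.1.ae_eq_mk, ae_restrict_mem hU] with x h1 h2 h3
    have : x ∈ S := ⟨h3, by simpa [hm, ← h2] using h1⟩
    rw [indicator_of_mem this, hm, ← h2]

/-- Bump functions shrinking to the origin. -/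
noncomputable def shrinkingBump (n : ℕ) (k : ℕ) : ContDiffBump (0 : EuclideanSpace ℝ (Fin n)) where
  rIn := 1 / ((k : ℝ) + 1)
  rOut := 2 / ((k : ℝ) + 1)
  rIn_pos := by positivity
  rIn_lt_rOut := by gcongr; norm_num

theorem tendsto_shrinkingBump_rOut (n : ℕ) :
    Tendsto (fun k => (shrinkingBump n k).rOut) atTop (𝓝 0) := by
  have := (tendsto_one_div_add_atTop_nhds_zero_nat (𝕜 := ℝ)).const_mul 2
  simpa [shrinkingBump, div_eq_mul_inv] using this

variable {n : ℕ} {U : Set (EuclideanSpace ℝ (Fin n))}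
  {V : Type*} [NormedAddCommGroup V] [NormedSpace ℝ V]

/-- Mollification at scale `k`. -/
noncomputable def mollify (k : ℕ) (f : EuclideanSpace ℝ (Fin n) → V) :
    EuclideanSpace ℝ (Fin n) → V :=
  (shrinkingBump n k).normed volume ⋆[lsmul ℝ ℝ, volume] f

theorem contDiff_mollify (k : ℕ) {f : EuclideanSpace ℝ (Fin n) → V}
    (hf : LocallyIntegrable f volume) : ContDiff ℝ ∞ (mollify k f) :=
  (ContDiffBump.hasCompactSupport_normed _).contDiff_convolution_left _
    ((shrinkingBump n k).contDiff_normed (n := ⊤)) hf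

theorem norm_mollify_le (k : ℕ) {f : EuclideanSpace ℝ (Fin n) → V} {C : ℝ}
    (hC : ∀ x, ‖f x‖ ≤ C) (x : EuclideanSpace ℝ (Fin n)) : ‖mollify k f x‖ ≤ C := by
  rw [mollify, convolution_lsmul]
  refine (norm_integral_le_of_norm_le ((shrinkingBump n k).integrable_normed.mul_const C)
    (Eventually.of_forall fun t => ?_)).trans_eq ?_
  · rw [norm_smul, Real.norm_of_nonneg ((shrinkingBump n k).nonneg_normed t)]
    exact mul_le_mul_of_nonneg_left (hC _) ((shrinkingBump n k).nonneg_normed t)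
  · rw [integral_mul_const, ContDiffBump.integral_normed, one_mul]

theorem ae_tendsto_mollify [CompleteSpace V] {f : EuclideanSpace ℝ (Fin n) → V} (hf : LocallyIntegrable f volume) :
    ∀ᵐ x, Tendsto (fun k => mollify k f x) atTop (𝓝 (f x)) := by
  -- Lebesgue differentiation applies because the outer radius stays within a fixed multiple of the
  -- inner one.
  refine ContDiffBump.ae_convolution_tendsto_right_of_locallyIntegrable (K := 2)
    (tendsto_shrinkingBump_rOut n) (Eventually.of_forall fun k => ?_) hf
  simp [shrinkingBump, div_eq_mul_inv]

theorem integrable_of_bounded_of_support {W : Type*} [NormedAddCommGroup W]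
    (hU : MeasurableSet U) (hUb : Bornology.IsBounded U) {f : EuclideanSpace ℝ (Fin n) → W} (hf : StronglyMeasurable f) {C : ℝ}
    (hC : ∀ x, ‖f x‖ ≤ C) (h0 : ∀ x ∉ U, f x = 0) : Integrable f volume := by
  have hfin : IsFiniteMeasure (volume.restrict U) :=
    ⟨by rw [Measure.restrict_apply_univ]; exact hUb.measure_lt_top⟩
  have : IntegrableOn f U volume :=
    Integrable.of_bound hf.aestronglyMeasurable C (Eventually.of_forall hC)
  rw [← integrable_indicator_iff hU] at this
  rwa [indicator_eq_self.2] at this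
  intro x hx
  by_contra hxU
  exact hx (h0 x hxU)

/-- The gradient of a mollification is the mollification of the weak gradient. -/
theorem gradient_mollify (k : ℕ) {f : EuclideanSpace ℝ (Fin n) → ℝ}
    {g : EuclideanSpace ℝ (Fin n) → EuclideanSpace ℝ (Fin n)}
    (hf : Integrable f volume) (hg : Integrable g volume)
    (hf0 : ∀ x ∉ U, f x = 0) (hg0 : ∀ x ∉ U, g x = 0)
    (h : IsWeakGradient U f g) {x : EuclideanSpace ℝ (Fin n)}
    (hx : Metric.closedBall x (shrinkingBump n k).rOut ⊆ U) :
    gradient (mollify k f) x = mollify k g x := by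
  set ρ := (shrinkingBump n k).normed volume with hρ
  have hρs : HasCompactSupport ρ := ContDiffBump.hasCompactSupport_normed _
  have hρd : ContDiff ℝ ∞ ρ := (shrinkingBump n k).contDiff_normed (n := ⊤)
  -- The reflected kernel is a test function in `U` thanks to `hx`. Differentiating it in `t`
  -- instead of `x` changes the sign, and this cancels the minus sign in the definition of the weak
  -- gradient.
  set ψ : EuclideanSpace ℝ (Fin n) → ℝ := fun t => ρ (x - t) with hψdef
  have hψsupp : tsupport ψ ⊆ Metric.closedBall x (shrinkingBump n k).rOut := by
    refine closure_minimal (fun t ht => ?_) Metric.isClosed_closedBall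
    have : x - t ∈ Function.support ρ := ht
    rw [hρ, ContDiffBump.support_normed_eq] at this
    rw [Metric.mem_closedBall, dist_comm, dist_eq_norm]
    simpa using (mem_ball_zero_iff.1 this).le
  have hψ : IsTestFunction U ψ :=
    ⟨hρd.comp (contDiff_const.sub contDiff_id),
      (isCompact_closedBall _ _).of_isClosed_subset (isClosed_tsupport _) hψsupp,
      hψsupp.trans hx⟩
  have hfd : ∀ t, fderiv ℝ ψ t = -fderiv ℝ ρ (x - t) := fun t => by
    have := ((hρd.differentiable (by simp) (x - t)).hasFDerivAt.comp t
      ((hasFDerivAt_id t).const_sub x)).fderiv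
    rw [hψdef]
    refine this.trans ?_
    ext v
    simp
  have hD : HasFDerivAt (mollify k f)
      ((fderiv ℝ ρ ⋆[(lsmul ℝ ℝ).precompL (EuclideanSpace ℝ (Fin n)), volume] f) x) x :=
    hρs.hasFDerivAt_convolution_left _ (hρd.of_le (by simp)) hf.locallyIntegrable x
  have hint1 := (hρs.fderiv ℝ).convolutionExists_left
    ((lsmul ℝ ℝ).precompL (EuclideanSpace ℝ (Fin n)))
    (hρd.continuous_fderiv (by simp)) hf.locallyIntegrable x
  have hint1' := hint1.integrable_swap
  obtain ⟨C, hC⟩ := hψ.exists_abs_le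
  obtain ⟨D, hDb⟩ := hψ.exists_norm_gradient_le
  have hint2 : Integrable (fun t => f t • gradient ψ t) volume :=
    hf.smul_bdd D hψ.continuous_gradient.aestronglyMeasurable (Eventually.of_forall hDb)
  have hint3 : Integrable (fun t => ψ t • g t) volume :=
    hg.bdd_smul C hψ.continuous.aestronglyMeasurable (Eventually.of_forall hC)
  have hweak : ∫ t, f t • gradient ψ t = - ∫ t, ψ t • g t := by
    have := h ψ hψ
    rwa [setIntegral_eq_integral_of_forall_compl_eq_zero fun t ht => by simp [hf0 t ht],
      setIntegral_eq_integral_of_forall_compl_eq_zero fun t ht => by simp [hg0 t ht]] at this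
  have hmol : mollify k g x = ∫ t, ψ t • g t := by
    rw [mollify, convolution_eq_swap]
    rfl
  refine ext_inner_right ℝ fun v => ?_
  rw [hmol, gradient, InnerProductSpace.toDual_symm_apply, hD.fderiv, convolution_eq_swap,
    ContinuousLinearMap.integral_apply hint1']
  rw [← neg_neg (∫ t, ψ t • g t), ← hweak, inner_neg_left, real_inner_comm,
    ← integral_inner hint2, ← integral_neg]
  refine integral_congr_ae (Eventually.of_forall fun t => ?_)
  simp only [inner_smul_right]
  rw [real_inner_comm, gradient, InnerProductSpace.toDual_symm_apply, hfd]
  simp [mul_comm]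

/-- Smooth approximation of Sobolev functions. -/
theorem SobolevW1Inf.exists_smooth_approximation (hU : IsOpen U) (hUb : Bornology.IsBounded U)
    (φ : SobolevW1Inf U) :
    ∃ (f : ℕ → EuclideanSpace ℝ (Fin n) → ℝ) (φ' : EuclideanSpace ℝ (Fin n) → ℝ) (C : ℝ), 0 ≤ C ∧
      (∀ k, ContDiff ℝ ∞ (f k)) ∧ (∀ k x, |f k x| ≤ C) ∧
      (∀ K ⊆ U, IsCompact K → ∀ᶠ k in atTop, ∀ x ∈ K, ‖gradient (f k) x‖ ≤ C) ∧
      Measurable φ' ∧ (∀ x, |φ' x| ≤ C) ∧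
      (∀ x ∈ U, Tendsto (fun k => f k x) atTop (𝓝 (φ' x))) ∧ (∀ x ∉ U, φ' x = 0) ∧
      φ' =ᵐ[volume.restrict U] φ.toFun ∧
      (∀ᵐ x ∂volume.restrict U, Tendsto (fun k => gradient (f k) x) atTop (𝓝 (φ.grad x))) := by
  obtain ⟨p, M, hpm, hpM, hp0, hpφ, hM0⟩ :=
    φ.memLp_toFun.exists_bounded_representative hU.measurableSet
  obtain ⟨g, L, hgm, hgL, hg0, hgφ, hL0⟩ :=
    φ.memLp_grad.exists_bounded_representative hU.measurableSet
  have hpi := integrable_of_bounded_of_support hU.measurableSet hUb hpm hpM hp0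
  have hgi := integrable_of_bounded_of_support hU.measurableSet hUb hgm hgL hg0
  have hweak : IsWeakGradient U p g := fun ψ hψ => by
    rw [integral_congr_ae (g := fun x => φ.toFun x • gradient ψ x), φ.isWeakGradient ψ hψ,
      integral_congr_ae (f := fun x => ψ x • φ.grad x) (g := fun x => ψ x • g x)]
    · filter_upwards [hgφ] with x hx
      rw [hx]
    · filter_upwards [hpφ] with x hx
      rw [hx]
  have hgrad : ∀ K ⊆ U, IsCompact K → ∀ᶠ k in atTop, ∀ x ∈ K,
      gradient (mollify k p) x = mollify k g x := by
    intro K hKU hK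
    obtain ⟨r, hr, hrU⟩ := hK.exists_cthickening_subset_open hU hKU
    filter_upwards [(tendsto_shrinkingBump_rOut n).eventually_le_const hr] with k hk x hx
    refine gradient_mollify k hpi hgi hp0 hg0 hweak ?_
    exact (Metric.closedBall_subset_closedBall hk).trans
      ((Metric.closedBall_subset_cthickening hx r).trans hrU)
  have hpae := ae_tendsto_mollify hpi.locallyIntegrable
  -- Convergence is needed at every point of `U`, since `div F` may charge Lebesgue null sets. Near
  -- `x` the mollifications eventually share the Lipschitz constant `L`, and they converge at points
  -- `y` arbitrarily close to `x`; so they are Cauchy at `x`.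
  have hconv : ∀ x ∈ U, ∃ y, Tendsto (fun k => mollify k p x) atTop (𝓝 y) := by
    intro x hx
    obtain ⟨r, hr, hrU⟩ := Metric.nhds_basis_closedBall.mem_iff.1 (hU.mem_nhds hx)
    have hlip : ∀ᶠ k in atTop, ∀ y ∈ Metric.closedBall x r,
        |mollify k p y - mollify k p x| ≤ L * ‖y - x‖ := by
      filter_upwards [hgrad _ hrU (isCompact_closedBall x r)] with k hk y hy
      refine Convex.norm_image_sub_le_of_norm_fderiv_le (𝕜 := ℝ)
        (fun z _ => (contDiff_mollify k hpi.locallyIntegrable).differentiable (by simp) z)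
        (fun z hz => ?_) (convex_closedBall x r) (Metric.mem_closedBall_self hr.le) hy
      have := norm_mollify_le k hgL z
      rw [← hk z hz] at this
      simpa [gradient] using this
    refine cauchySeq_tendsto_of_complete (Metric.cauchySeq_iff'.2 fun ε hε => ?_)
    set s := min r (ε / (4 * (L + 1))) with hs
    have hs0 : 0 < s := lt_min hr (by positivity)
    obtain ⟨y, hys, hy⟩ : ∃ y ∈ Metric.ball x s,
        Tendsto (fun k => mollify k p y) atTop (𝓝 (p y)) := by
      by_contra! hcon
      have h0 : volume (Metric.ball x s) = 0 :=
        measure_mono_null (fun y hy => hcon y hy) hpae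
      exact (Metric.measure_ball_pos volume x hs0).ne' h0
    have hyr : y ∈ Metric.closedBall x r :=
      Metric.ball_subset_closedBall (Metric.ball_subset_ball (min_le_left _ _) hys)
    have hyx : L * ‖y - x‖ ≤ ε / 4 := by
      have h1 : ‖y - x‖ ≤ ε / (4 * (L + 1)) := by
        rw [← dist_eq_norm]
        exact (Metric.mem_ball.1 hys).le.trans (min_le_right _ _)
      calc L * ‖y - x‖ ≤ (L + 1) * (ε / (4 * (L + 1))) := by gcongr; linarith
        _ = ε / 4 := by field_simp
    obtain ⟨N₁, hN₁⟩ := eventually_atTop.1 hlip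
    obtain ⟨N₂, hN₂⟩ := Metric.cauchySeq_iff.1 hy.cauchySeq (ε / 4) (by positivity)
    refine ⟨max N₁ N₂, fun k hk => ?_⟩
    have a1 := abs_le.1 (hN₁ k ((le_max_left _ _).trans hk) y hyr)
    have a2 := abs_le.1 (hN₁ _ (le_max_left N₁ N₂) y hyr)
    have a3 := abs_lt.1 (hN₂ k ((le_max_right _ _).trans hk) _ (le_max_right N₁ N₂))
    rw [Real.dist_eq, abs_lt]
    constructor <;> linarith [a1.1, a1.2, a2.1, a2.2, a3.1, a3.2]
  choose! lim hlim using hconv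
  have hlim' : ∀ x, Tendsto (fun k => U.indicator (mollify k p) x) atTop (𝓝 (U.indicator lim x)) :=
    fun x => by
      by_cases hx : x ∈ U
      · simpa [hx] using hlim x hx
      · simp [hx]
  refine ⟨fun k => mollify k p, U.indicator lim, max M L, hM0.trans (le_max_left _ _),
    fun k => contDiff_mollify k hpi.locallyIntegrable,
    fun k x => (norm_mollify_le k hpM x).trans (le_max_left _ _), ?_, ?_, ?_, ?_, ?_, ?_, ?_⟩
  · intro K hKU hK
    filter_upwards [hgrad K hKU hK] with k hk x hx
    rw [hk x hx]
    exact (norm_mollify_le k hgL x).trans (le_max_right _ _)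
  · exact measurable_of_tendsto_metrizable
      (fun k => (contDiff_mollify k hpi.locallyIntegrable).continuous.measurable.indicator
        hU.measurableSet) (tendsto_pi_nhds.2 hlim')
  · intro x
    refine le_of_tendsto (hlim' x).abs (Eventually.of_forall fun k => ?_)
    by_cases hx : x ∈ U
    · simpa [hx] using .inl (norm_mollify_le k hpM x)
    · simpa [hx] using .inl hM0
  · intro x hx
    simpa [hx] using hlim x hx
  · intro x hx
    simp [hx]
  · filter_upwards [ae_restrict_of_ae hpae, hpφ, ae_restrict_mem hU.measurableSet] with x h1 h2 h3
    rw [← h2, indicator_of_mem h3]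
    exact tendsto_nhds_unique (hlim x h3) h1
  · filter_upwards [ae_restrict_of_ae (ae_tendsto_mollify hgi.locallyIntegrable), hgφ,
      ae_restrict_mem hU.measurableSet] with x h1 h2 h3
    rw [← h2]
    refine h1.congr' ?_
    filter_upwards [hgrad {x} (by simpa using h3) isCompact_singleton] with k hk
    exact (hk x rfl).symm

end Mollification

/-! ### The product rule -/

section ProductRule

variable {n : ℕ} {U : Set (EuclideanSpace ℝ (Fin n))}
  {F : EuclideanSpace ℝ (Fin n) → EuclideanSpace ℝ (Fin n)}

theorem SobolevW1Inf.memLp_smul (φ : SobolevW1Inf U) (hF : MemLp F 1 (volume.restrict U)) :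
    MemLp (fun x => φ.toFun x • F x) 1 (volume.restrict U) :=
  hF.smul φ.memLp_toFun

theorem gradient_mul {f g : EuclideanSpace ℝ (Fin n) → ℝ} {x : EuclideanSpace ℝ (Fin n)}
    (hf : DifferentiableAt ℝ f x) (hg : DifferentiableAt ℝ g x) :
    gradient (fun y => f y * g y) x = f x • gradient g x + g x • gradient f x := by
  simp [gradient, fderiv_fun_mul hf hg]

/-- The product of a bounded Sobolev function and a field with divergence measure is a field with
divergence measure. -/
theorem IsDivMeasure.exists_smul (hU : IsOpen U) (hUb : Bornology.IsBounded U)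
    (hF : MemLp F 1 (volume.restrict U)) {ν : SignedMeasure (EuclideanSpace ℝ (Fin n))}
    (h : IsDivMeasure U F ν) (φ : SobolevW1Inf U) :
    ∃ ν', IsDivMeasure U (fun x => φ.toFun x • F x) ν' := by
  obtain ⟨f, p, C, hC0, hfd, hfC, hfg, hpm, hpC, hfp, hp0, hpφ, hgφ⟩ :=
    φ.exists_smooth_approximation hU hUb
  obtain ⟨μ, d, _, hd, rfl⟩ := exists_eq_withDensityᵥ ν
  have hFi := memLp_one_iff_integrable.1 hF
  have hpd : Integrable (fun x => p x * d x) μ :=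
    hd.bdd_mul hpm.aestronglyMeasurable (Eventually.of_forall hpC)
  have hFg : Integrable (fun x => inner ℝ (F x) (φ.grad x)) (volume.restrict U) := by
    have hgm : MemLp (fun x => ‖φ.grad x‖) ∞ (volume.restrict U) := φ.memLp_grad.norm
    have : MemLp (fun x => ‖φ.grad x‖ • F x) 1 (volume.restrict U) := hF.smul hgm
    refine (memLp_one_iff_integrable.1 this).mono (hFi.1.inner φ.memLp_grad.1)
      (Eventually.of_forall fun x => ?_)
    rw [norm_smul, norm_norm, mul_comm]
    exact norm_inner_le_norm _ _
  -- The product rule `div(φF) = φ div F + F · Dφ`, where in the first term `φ` is replaced by its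
  -- representative `p`, the limit of the mollifications at every point of `U`.
  refine ⟨μ.withDensityᵥ (fun x => p x * d x) +
    (volume.restrict U).withDensityᵥ (fun x => inner ℝ (F x) (φ.grad x)), ?_, fun ψ hψ => ?_⟩
  · ext A hA
    rw [VectorMeasure.restrict_apply _ hU.measurableSet hA]
    have hAU := hA.inter hU.measurableSet
    simp only [_root_.add_apply]
    rw [withDensityᵥ_apply hpd hA, withDensityᵥ_apply hpd hAU, withDensityᵥ_apply hFg hA,
      withDensityᵥ_apply hFg hAU]
    congr 1
    · refine (setIntegral_eq_of_subset_of_forall_sdiff_eq_zero hA inter_subset_left fun x hx => ?_).symm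
      rw [hp0 x fun hxU => hx.2 ⟨hx.1, hxU⟩, zero_mul]
    · rw [Measure.restrict_restrict hA, Measure.restrict_restrict hAU, inter_assoc, inter_self]
  obtain ⟨B, hB⟩ := hψ.exists_abs_le
  obtain ⟨D, hD⟩ := hψ.exists_norm_gradient_le
  have hB0 : 0 ≤ B := (abs_nonneg _).trans (hB 0)
  have hD0 : 0 ≤ D := (norm_nonneg _).trans (hD 0)
  have hprod : ∀ k, IsTestFunction U fun x => f k x * ψ x := fun k =>
    ⟨(hfd k).mul hψ.1, hψ.2.1.mul_left,
      (closure_mono (Function.support_mul_subset_right _ _)).trans hψ.2.2⟩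
  have hgp : ∀ k x, gradient (fun y => f k y * ψ y) x =
      f k x • gradient ψ x + ψ x • gradient (f k) x := fun k x =>
    gradient_mul ((hfd k).differentiable (by simp) x) (hψ.1.differentiable (by simp) x)
  have hL : Tendsto (fun k => ∫ x in U, inner ℝ (F x) (gradient (fun y => f k y * ψ y) x)) atTop
      (𝓝 (∫ x in U, inner ℝ (F x) (φ.toFun x • gradient ψ x + ψ x • φ.grad x))) := by
    refine tendsto_integral_filter_of_dominated_convergence
      (fun x => ‖F x‖ * (C * D + B * C)) ?_ ?_ ?_ ?_
    · exact Eventually.of_forall fun k => ((hprod k).integrable_inner_gradient hF).1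
    -- The gradients of the approximations are controlled only on compact subsets of `U`; the
    -- support of `ψ` is one, and off it the term with `ψ` is zero.
    · filter_upwards [hfg _ hψ.2.2 hψ.2.1] with k hk
      refine Eventually.of_forall fun x => ?_
      refine (norm_inner_le_norm _ _).trans (mul_le_mul_of_nonneg_left ?_ (norm_nonneg _))
      rw [hgp]
      refine (norm_add_le _ _).trans (add_le_add ?_ ?_)
      · rw [norm_smul]
        exact mul_le_mul (hfC k x) (hD x) (norm_nonneg _) hC0
      · by_cases hx : x ∈ tsupport ψ
        · rw [norm_smul]
          exact mul_le_mul (hB x) (hk x hx) (norm_nonneg _) hB0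
        · rw [image_eq_zero_of_notMem_tsupport hx, zero_smul, norm_zero]
          positivity
    · exact hFi.norm.mul_const _
    · filter_upwards [hgφ, hpφ, ae_restrict_mem hU.measurableSet] with x h1 h2 h3
      simp only [hgp]
      rw [← h2]
      exact tendsto_const_nhds.inner (((hfp x h3).smul_const _).add (h1.const_smul _))
  have hR : Tendsto (fun k => ∫ x, f k x * ψ x * d x ∂μ) atTop
      (𝓝 (∫ x, ψ x * (p x * d x) ∂μ)) := by
    refine tendsto_integral_filter_of_dominated_convergence (fun x => C * B * ‖d x‖) ?_ ?_ ?_ ?_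
    · exact Eventually.of_forall fun k =>
        ((hprod k).continuous.aestronglyMeasurable).mul hd.1
    · refine Eventually.of_forall fun k => Eventually.of_forall fun x => ?_
      rw [norm_mul, norm_mul]
      gcongr
      · exact hfC k x
      · exact hB x
    · exact hd.norm.const_mul _
    · refine Eventually.of_forall fun x => ?_
      by_cases hx : x ∈ U
      · have := ((hfp x hx).mul_const (ψ x)).mul_const (d x)
        rwa [mul_comm (p x), mul_assoc] at this
      · have : ψ x = 0 := image_eq_zero_of_notMem_tsupport fun h' => hx (hψ.2.2 h')
        simp [this]
  have heq : ∀ k, ∫ x in U, inner ℝ (F x) (gradient (fun y => f k y * ψ y) x) =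
      -∫ x, f k x * ψ x * d x ∂μ := fun k => by
    rw [h.2 _ (hprod k), (hprod k).integral_withDensityᵥ μ hd]
  simp only [heq] at hL
  have hlim := tendsto_nhds_unique hL hR.neg
  have i1 : Integrable (fun x => inner ℝ (φ.toFun x • F x) (gradient ψ x)) (volume.restrict U) :=
    hψ.integrable_inner_gradient (φ.memLp_smul hF)
  have i2 : Integrable (fun x => ψ x * inner ℝ (F x) (φ.grad x)) (volume.restrict U) :=
    hFg.bdd_mul hψ.continuous.aestronglyMeasurable (Eventually.of_forall hB)
  have hsplit : ∫ x in U, inner ℝ (F x) (φ.toFun x • gradient ψ x + ψ x • φ.grad x) =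
      (∫ x in U, inner ℝ (φ.toFun x • F x) (gradient ψ x)) +
        ∫ x in U, ψ x * inner ℝ (F x) (φ.grad x) := by
    rw [← integral_add i1 i2]
    simp only [inner_add_right, inner_smul_left, inner_smul_right, RCLike.conj_to_real]
  rw [VectorMeasure.integral_add_vectorMeasure (hψ.integrable_variation _)
    (hψ.integrable_variation _), hψ.integral_withDensityᵥ _ hpd, hψ.integral_withDensityᵥ _ hFg]
  rw [hsplit] at hlim
  linarith

end ProductRule

/-! ### Lipschitz functions and tent functions -/

section Lipschitz

variable {n : ℕ}

/-- A bounded Lipschitz function belongs to `W^{1,∞}`. -/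
noncomputable def SobolevW1Inf.ofLipschitz (U : Set (EuclideanSpace ℝ (Fin n)))
    (f : EuclideanSpace ℝ (Fin n) → ℝ) (hf : ∃ K, LipschitzWith K f) (hb : ∃ C, ∀ x, |f x| ≤ C) :
    SobolevW1Inf U where
  toFun := f
  grad := gradient f
  memLp_toFun := memLp_top_of_bound hf.choose_spec.continuous.aestronglyMeasurable _
    (Eventually.of_forall hb.choose_spec)
  memLp_grad := by
    obtain ⟨K, hK⟩ := hf
    refine memLp_top_of_bound (C := K) ?_ (Eventually.of_forall fun x => ?_)
    · exact ((InnerProductSpace.toDual ℝ _).symm.continuous.measurable.comp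
        (measurable_fderiv ℝ f)).aestronglyMeasurable
    · simpa [gradient] using norm_fderiv_le_of_lipschitz ℝ hK
  isWeakGradient ψ hψ := by
    obtain ⟨K, hK⟩ := hf
    obtain ⟨D, hD⟩ := hψ.1.lipschitzWith_of_hasCompactSupport hψ.2.1 (by simp)
    have h1 : Integrable (fun x => f x • gradient ψ x) :=
      (hK.continuous.smul hψ.continuous_gradient).integrable_of_hasCompactSupport
        hψ.hasCompactSupport_gradient.smul_left
    have h2 : Integrable (fun x => ψ x • gradient f x) := by
      have hm : AEStronglyMeasurable (gradient f) volume :=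
        ((InnerProductSpace.toDual ℝ _).symm.continuous.measurable.comp
          (measurable_fderiv ℝ f)).aestronglyMeasurable
      refine (hψ.continuous.integrable_of_hasCompactSupport hψ.2.1).smul_bdd (K : ℝ) hm ?_
      exact Eventually.of_forall fun x => by
        simpa [gradient] using norm_fderiv_le_of_lipschitz ℝ hK
    have h0 : ∀ x ∉ U, x ∉ tsupport ψ := fun x hx h => hx (hψ.2.2 h)
    rw [setIntegral_eq_integral_of_forall_compl_eq_zero fun x hx => by
        rw [gradient_eq_zero_of_notMem_tsupport (h0 x hx), smul_zero],
      setIntegral_eq_integral_of_forall_compl_eq_zero fun x hx => by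
        rw [image_eq_zero_of_notMem_tsupport (h0 x hx), zero_smul]]
    -- Pairing with a vector `v` reduces the claim to integration by parts for the line derivative
    -- of a Lipschitz function, which Rademacher's theorem identifies with the gradient almost
    -- everywhere.
    refine ext_inner_left ℝ fun v => ?_
    rw [inner_neg_right, ← integral_inner h1, ← integral_inner h2]
    have key := hK.integral_lineDeriv_mul_eq (μ := volume) hD hψ.2.1 v
    have e1 : ∫ x, lineDeriv ℝ f x v * ψ x = ∫ x, inner ℝ v (ψ x • gradient f x) := by
      refine integral_congr_ae ?_
      filter_upwards [hK.ae_differentiableAt] with x hx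
      rw [hx.lineDeriv_eq_fderiv, inner_smul_right, real_inner_comm, gradient,
        InnerProductSpace.toDual_symm_apply, mul_comm]
    have e2 : ∫ x, lineDeriv ℝ ψ x (-v) * f x = -∫ x, inner ℝ v (f x • gradient ψ x) := by
      rw [← integral_neg]
      refine integral_congr_ae (Eventually.of_forall fun x => ?_)
      simp only
      rw [(hψ.1.differentiable (by simp) x).lineDeriv_eq_fderiv, inner_smul_right,
        real_inner_comm, gradient, InnerProductSpace.toDual_symm_apply, map_neg]
      ring
    rw [← e1, key, e2, neg_neg]

/-- This form makes Lipschitz continuity evident. It fails for empty `K`: there `Metric.infDist` is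
zero and the right side is one, while the tent is zero. -/
theorem tent_eq {K : Set (EuclideanSpace ℝ (Fin n))} (hK : K.Nonempty) {δ : ℝ} (hδ : 0 < δ)
    (x : EuclideanSpace ℝ (Fin n)) :
    tent K δ x = max 0 (min 1 (2 - 2 / δ * Metric.infDist x K)) := by
  have hmem : ∀ r, x ∈ Metric.thickening r K ↔ Metric.infDist x K < r := fun r => by
    rw [Metric.mem_thickening_iff_infDist_lt hK]
  rw [tent]
  simp only [hmem]
  have hd : 2 / δ * Metric.infDist x K = 2 * (Metric.infDist x K / δ) := by ring
  rw [hd]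
  split_ifs with h1 h2
  · have : Metric.infDist x K / δ < 1 / 2 := by
      rw [div_lt_iff₀ hδ]
      linarith
    rw [min_eq_left (by linarith), max_eq_right zero_le_one]
  · have a1 : Metric.infDist x K / δ < 1 := by
      rw [div_lt_iff₀ hδ]
      linarith
    have a2 : 1 / 2 ≤ Metric.infDist x K / δ := by
      rw [le_div_iff₀ hδ]
      linarith
    rw [min_eq_right (by linarith), max_eq_right (by linarith)]
  · have a1 : 1 ≤ Metric.infDist x K / δ := by
      rw [le_div_iff₀ hδ]
      linarith
    rw [max_eq_left]
    exact (min_le_right _ _).trans (by linarith)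

theorem exists_lipschitzWith_tent (K : Set (EuclideanSpace ℝ (Fin n))) {δ : ℝ} (hδ : 0 < δ) :
    ∃ C, LipschitzWith C (tent K δ) := by
  rcases K.eq_empty_or_nonempty with rfl | hK
  · refine ⟨0, ?_⟩
    have : tent (∅ : Set (EuclideanSpace ℝ (Fin n))) δ = fun _ => 0 := by
      ext x
      simp [tent]
    rw [this]
    exact LipschitzWith.const 0
  · have : tent K δ = fun x => max 0 (min 1 (2 - 2 / δ * Metric.infDist x K)) :=
      funext (tent_eq hK hδ)
    rw [this]
    refine ⟨_, LipschitzWith.const_max (LipschitzWith.const_min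
      ((LipschitzWith.const (2 : ℝ)).sub ((lipschitzWith_smul (2 / δ)).comp
        (Metric.lipschitz_infDist_pt K))) 1) 0⟩

theorem abs_tent_le (K : Set (EuclideanSpace ℝ (Fin n))) {δ : ℝ} (hδ : 0 < δ)
    (x : EuclideanSpace ℝ (Fin n)) : |tent K δ x| ≤ 1 := by
  rcases K.eq_empty_or_nonempty with rfl | hK
  · simp [tent]
  · rw [tent_eq hK hδ, abs_of_nonneg (le_max_left _ _)]
    exact max_le zero_le_one (min_le_left _ _)

theorem tent_eq_one (K : Set (EuclideanSpace ℝ (Fin n))) {δ : ℝ}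
    {x : EuclideanSpace ℝ (Fin n)} (hx : x ∈ Metric.thickening (δ / 2) K) : tent K δ x = 1 := by
  rw [tent, if_pos hx]

end Lipschitz

namespace BddAddMeasure

variable {α : Type*} [MeasurableSpace α] {σ : Measure α}

@[ext]
theorem ext_toFun {V : Type*} [NormedAddCommGroup V] {μ ν : BddAddMeasure σ V}
    (h : μ.toFun = ν.toFun) : μ = ν := by
  cases μ
  cases ν
  congr

/-! ### Measures from functionals -/

theorem _root_.MeasureTheory.ae_norm_le_toReal_eLpNorm_top {V : Type*} [NormedAddCommGroup V]
    {f : α → V} (hf : eLpNorm f ∞ σ ≠ ⊤) : ∀ᵐ x ∂σ, ‖f x‖ ≤ (eLpNorm f ∞ σ).toReal := by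
  rw [eLpNorm_exponent_top] at hf ⊢
  filter_upwards [enorm_ae_le_eLpNormEssSup f σ] with x hx
  simpa using ENNReal.toReal_mono hf hx

theorem _root_.MeasureTheory.toReal_eLpNorm_top_le {V : Type*} [NormedAddCommGroup V]
    {f : α → V} {c : ℝ} (hc : 0 ≤ c) (h : ∀ᵐ x ∂σ, ‖f x‖ ≤ c) : (eLpNorm f ∞ σ).toReal ≤ c := by
  refine ENNReal.toReal_le_of_le_ofReal hc ?_
  rw [eLpNorm_exponent_top]
  exact eLpNormEssSup_le_of_ae_bound h

/-- The finitely additive measure `B ↦ ℓ(1_B)` of a functional bounded on `L^∞`. -/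
noncomputable def ofFunctional (σ : Measure α) (ℓ : (α → ℝ) →ₗ[ℝ] ℝ) (K : ℝ)
    (hℓ : ∀ f, MemLp f ∞ σ → |ℓ f| ≤ K * (eLpNorm f ∞ σ).toReal) : BddAddMeasure σ ℝ where
  -- The value zero on non-measurable sets makes the measure of a functional vanishing on `L^∞`
  -- literally equal to `0`.
  toFun B := open Classical in if MeasurableSet B then ℓ (B.indicator 1) else 0
  additive A B hA hB h := by
    rw [if_pos hA, if_pos hB, if_pos (hA.union hB), ← map_add, indicator_union_of_disjoint h]
    rfl
  bounded := by
    refine ⟨|K|, fun A hA => ?_⟩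
    have h1 : ∀ x, ‖A.indicator (1 : α → ℝ) x‖ ≤ 1 := fun x => by
      by_cases hx : x ∈ A <;> simp [hx]
    have hm : AEStronglyMeasurable (A.indicator (1 : α → ℝ)) σ :=
      (stronglyMeasurable_const (b := (1 : ℝ)) |>.indicator hA).aestronglyMeasurable
    rw [if_pos hA]
    refine (hℓ _ (memLp_top_of_bound hm 1 (Eventually.of_forall h1))).trans ?_
    refine (mul_le_mul_of_nonneg_right (le_abs_self K) ENNReal.toReal_nonneg).trans ?_
    exact mul_le_of_le_one_right (abs_nonneg K)
      (toReal_eLpNorm_top_le zero_le_one (Eventually.of_forall h1))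
  weaklyAbsCont A hA h := by
    have h0 : A.indicator (1 : α → ℝ) =ᵐ[σ] 0 := indicator_meas_zero h
    have hm : MemLp (A.indicator (1 : α → ℝ)) ∞ σ := MemLp.ae_eq h0.symm MemLp.zero
    have := hℓ _ hm
    rw [eLpNorm_congr_ae h0, eLpNorm_zero, ENNReal.toReal_zero, mul_zero] at this
    rw [if_pos hA]
    exact abs_eq_zero.1 (le_antisymm this (abs_nonneg _))

variable {ℓ : (α → ℝ) →ₗ[ℝ] ℝ} {K : ℝ}
  {hℓ : ∀ f, MemLp f ∞ σ → |ℓ f| ≤ K * (eLpNorm f ∞ σ).toReal}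

theorem ofFunctional_apply {B : Set α} (hB : MeasurableSet B) :
    (ofFunctional σ ℓ K hℓ).toFun B = ℓ (B.indicator 1) := by
  classical
  exact if_pos hB

theorem ofFunctional_eq_zero (h : ∀ f, MemLp f ∞ σ → ℓ f = 0) : ofFunctional σ ℓ K hℓ = 0 := by
  refine ext_toFun (funext fun B => ?_)
  by_cases hB : MeasurableSet B
  · rw [ofFunctional_apply hB]
    exact h _ (memLp_top_of_bound
      (stronglyMeasurable_const (b := (1 : ℝ)) |>.indicator hB).aestronglyMeasurable 1
      (Eventually.of_forall fun x => by by_cases hx : x ∈ B <;> simp [hx]))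
  · classical
    exact if_neg hB

theorem simpleIntegral_ofFunctional (s : SimpleFunc α ℝ) :
    (ofFunctional σ ℓ K hℓ).simpleIntegral s = ℓ s := by
  have hs : (s : α → ℝ) = ∑ y ∈ s.range, y • (s ⁻¹' {y}).indicator (1 : α → ℝ) := by
    ext x
    rw [Finset.sum_apply, Finset.sum_eq_single (s x)]
    · simp
    · intro y _ hy
      have : x ∉ s ⁻¹' {y} := fun h => hy (by simpa using h.symm)
      simp [this]
    · intro h
      exact absurd (s.mem_range_self x) h
  conv_rhs => rw [hs]
  rw [map_sum, simpleIntegral]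
  refine Finset.sum_congr rfl fun y _ => ?_
  rw [map_smul, ofFunctional_apply (s.measurableSet_fiber y), smul_eq_mul]

/-- By linearity the integral agrees with `ℓ` on simple functions; these are uniformly dense, and
`ℓ` is continuous for the `L^∞` norm. -/
theorem hasIntegral_ofFunctional {f : α → ℝ} (hf : MemLp f ∞ σ) :
    (ofFunctional σ ℓ K hℓ).HasIntegral f (ℓ f) := by
  choose s hs using fun k : ℕ => exists_simpleFunc_ae_abs_sub_le hf.1
    (ae_norm_le_toReal_eLpNorm_top hf.2.ne) (ε := 1 / ((k : ℝ) + 1)) (by positivity)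
  have he := tendsto_one_div_add_atTop_nhds_zero_nat (𝕜 := ℝ)
  refine hasIntegral_of_ae_abs_sub_le _ he hs ?_
  simp only [simpleIntegral_ofFunctional]
  rw [tendsto_iff_norm_sub_tendsto_zero]
  refine squeeze_zero (g := fun k : ℕ => |K| * (1 / ((k : ℝ) + 1))) (fun _ => norm_nonneg _)
    (fun k => ?_) (by simpa using he.const_mul |K|)
  have hm : MemLp (fun x => s k x - f x) ∞ σ :=
    memLp_top_of_bound ((s k).aestronglyMeasurable.sub hf.1) _ (hs k)
  rw [← map_sub]
  refine (hℓ _ hm).trans ((mul_le_mul_of_nonneg_right (le_abs_self K)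
    ENNReal.toReal_nonneg).trans ?_)
  exact mul_le_mul_of_nonneg_left (toReal_eLpNorm_top_le (by positivity) (hs k)) (abs_nonneg K)

/-- The vector-valued measure with given components. -/
noncomputable def ofComponents {n : ℕ} (m : Fin n → BddAddMeasure σ ℝ) :
    BddAddMeasure σ (EuclideanSpace ℝ (Fin n)) where
  toFun B := WithLp.toLp 2 fun j => (m j).toFun B
  additive A B hA hB h := by
    ext j
    simpa using (m j).additive A B hA hB h
  bounded := by
    choose C hC using fun j => (m j).bounded
    refine ⟨∑ j, |C j|, fun A hA => ?_⟩
    rw [EuclideanSpace.norm_eq]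
    refine Real.sqrt_le_iff.2 ⟨Finset.sum_nonneg fun _ _ => abs_nonneg _, ?_⟩
    refine (Finset.sum_le_sum fun j _ => ?_).trans
      (Finset.sum_sq_le_sq_sum_of_nonneg fun j _ => abs_nonneg (C j))
    exact pow_le_pow_left₀ (norm_nonneg _) ((hC j A hA).trans (le_abs_self _)) 2
  weaklyAbsCont A hA h := by
    ext j
    simpa using (m j).weaklyAbsCont A hA h

theorem ofComponents_eq_zero {n : ℕ} {m : Fin n → BddAddMeasure σ ℝ} (h : ∀ j, m j = 0) :
    ofComponents m = 0 := by
  refine ext_toFun (funext fun B => ?_)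
  change WithLp.toLp 2 (fun j => (m j).toFun B) = 0
  ext j
  change (m j).toFun B = 0
  rw [h j]
  rfl

/-! ### The core -/

section Core

variable {n : ℕ} {V : Type*} [NormedAddCommGroup V] {U : Set (EuclideanSpace ℝ (Fin n))}

theorem core_subset_closure {μ : BddAddMeasure (volume.restrict U) V}
    {A : Set (EuclideanSpace ℝ (Fin n))}
    (h : ∀ B, MeasurableSet B → Disjoint B A → μ.toFun B = 0) : μ.core ⊆ closure A := by
  intro x hx
  by_contra hxA
  have := hx (closure A)ᶜ isClosed_closure.isOpen_compl hxA
  rw [μ.totalVariation_eq_zero_of_forall fun B hB hBm => h B hBm ?_] at this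
  · exact lt_irrefl _ this
  · exact disjoint_left.2 fun y hy hyA => (hB hy).1 (subset_closure hyA)

/-- A measure is concentrated on every neighbourhood of its core. -/
theorem totalVariation_compl_eq_zero (hU : MeasurableSet U) (hUb : Bornology.IsBounded U)
    {μ : BddAddMeasure (volume.restrict U) V} {W : Set (EuclideanSpace ℝ (Fin n))} (hW : IsOpen W)
    (h : μ.core ⊆ W) : μ.totalVariation (W ∩ U)ᶜ = 0 := by
  have hK : IsCompact (closure U \ W) := hUb.isCompact_closure.diff hW
  obtain ⟨O, hO, hKO, hO0⟩ : ∃ O, IsOpen O ∧ closure U \ W ⊆ O ∧ μ.totalVariation (O ∩ U) = 0 := by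
    -- Each point off the core has a neighbourhood of zero variation. Finite additivity only allows
    -- finite unions of these, hence the appeal to compactness.
    refine hK.induction_on (p := fun S => ∃ O, IsOpen O ∧ S ⊆ O ∧ μ.totalVariation (O ∩ U) = 0)
      ⟨∅, isOpen_empty, subset_rfl, ?_⟩ ?_ ?_ ?_
    · exact μ.totalVariation_eq_zero_of_null (by simp)
    · rintro S T hST ⟨O, hO, hT, h0⟩
      exact ⟨O, hO, hST.trans hT, h0⟩
    · rintro S T ⟨O, hO, hS, h0⟩ ⟨O', hO', hT, h0'⟩
      refine ⟨O ∪ O', hO.union hO', union_subset_union hS hT, ?_⟩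
      rw [union_inter_distrib_right]
      refine nonpos_iff_eq_zero.1 ((μ.totalVariation_union_le (hO.measurableSet.inter hU)
        (hO'.measurableSet.inter hU)).trans ?_)
      rw [h0, h0', add_zero]
    · intro x hx
      have hxc : x ∉ μ.core := fun hx' => hx.2 (h hx')
      obtain ⟨O, hO, hxO, h0⟩ : ∃ O, IsOpen O ∧ x ∈ O ∧ μ.totalVariation (O ∩ U) = 0 := by
        by_contra hc
        exact hxc fun O hO hxO => pos_iff_ne_zero.2 fun h0 => hc ⟨O, hO, hxO, h0⟩
      exact ⟨O, mem_nhdsWithin_of_mem_nhds (hO.mem_nhds hxO), O, hO, subset_rfl, h0⟩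
  have hUc : μ.totalVariation Uᶜ = 0 := by
    refine μ.totalVariation_eq_zero_of_null ?_
    rw [Measure.restrict_apply hU.compl, compl_inter_self, measure_empty]
  refine nonpos_iff_eq_zero.1 ?_
  refine (μ.totalVariation_mono (hW.measurableSet.inter hU).compl
    ((hO.measurableSet.inter hU).union hU.compl) fun x hx => ?_).trans
    ((μ.totalVariation_union_le (hO.measurableSet.inter hU) hU.compl).trans ?_)
  · by_cases hxU : x ∈ U
    · exact Or.inl ⟨hKO ⟨subset_closure hxU, fun hxW => hx ⟨hxW, hxU⟩⟩, hxU⟩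
    · exact Or.inr hxU
  · rw [hO0, hUc, add_zero]

end Core

end BddAddMeasure

/-! ### The functional `φ ↦ div(φF)(Ω)` -/

section DivOn

variable {n : ℕ} {U Ω : Set (EuclideanSpace ℝ (Fin n))}
  {F : EuclideanSpace ℝ (Fin n) → EuclideanSpace ℝ (Fin n)}

/-- The number `div(fF)(Ω)`. -/
noncomputable def divOn (U Ω : Set (EuclideanSpace ℝ (Fin n)))
    (F : EuclideanSpace ℝ (Fin n) → EuclideanSpace ℝ (Fin n))
    (f : EuclideanSpace ℝ (Fin n) → ℝ) : ℝ :=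
  divMeasure U (fun x => f x • F x) Ω

theorem MemDM1.exists_isDivMeasure_smul (hU : IsOpen U) (hUb : Bornology.IsBounded U)
    (hF : MemDM1 U F) (φ : SobolevW1Inf U) :
    ∃ ν, IsDivMeasure U (fun x => φ.toFun x • F x) ν := by
  obtain ⟨hFi, ν, hν⟩ := hF
  exact hν.exists_smul hU hUb hFi φ

theorem IsDivMeasure.divOn_eq (hU : IsOpen U) {f : EuclideanSpace ℝ (Fin n) → ℝ}
    {ν : SignedMeasure (EuclideanSpace ℝ (Fin n))}
    (h : IsDivMeasure U (fun x => f x • F x) ν) : divOn U Ω F f = ν Ω := by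
  rw [divOn, h.divMeasure_eq hU]

theorem divOn_add (hU : IsOpen U) (hUb : Bornology.IsBounded U) (hF : MemDM1 U F)
    (φ ψ : SobolevW1Inf U) :
    divOn U Ω F (φ.toFun + ψ.toFun) = divOn U Ω F φ.toFun + divOn U Ω F ψ.toFun := by
  obtain ⟨ν, hν⟩ := hF.exists_isDivMeasure_smul hU hUb φ
  obtain ⟨ν', hν'⟩ := hF.exists_isDivMeasure_smul hU hUb ψ
  have h : IsDivMeasure U (fun x => (φ.toFun + ψ.toFun) x • F x) (ν + ν') := by
    simpa only [Pi.add_apply, add_smul] using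
      hν.add (φ.memLp_smul hF.1) (ψ.memLp_smul hF.1) hν'
  rw [h.divOn_eq hU, hν.divOn_eq hU, hν'.divOn_eq hU]
  rfl

theorem divOn_smul (hU : IsOpen U) (hUb : Bornology.IsBounded U) (hF : MemDM1 U F)
    (c : ℝ) (φ : SobolevW1Inf U) :
    divOn U Ω F (c • φ.toFun) = c * divOn U Ω F φ.toFun := by
  obtain ⟨ν, hν⟩ := hF.exists_isDivMeasure_smul hU hUb φ
  have h : IsDivMeasure U (fun x => (c • φ.toFun) x • F x) (c • ν) := by
    simpa only [Pi.smul_apply, smul_assoc] using hν.smul c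
  rw [h.divOn_eq hU, hν.divOn_eq hU]
  rfl

/-- The field `(f - g)F` vanishes near `∂Ω`, so its divergence does not charge `Ω`. The assumptions
concern the fields rather than `f` and `g`, so that products of Sobolev functions are admitted. -/
theorem divOn_congr (hU : IsOpen U) (hUb : Bornology.IsBounded U) (hΩ : MeasurableSet Ω)
    (hΩU : Ω ⊆ U) {f g : EuclideanSpace ℝ (Fin n) → ℝ}
    (hfi : MemLp (fun x => f x • F x) 1 (volume.restrict U))
    (hgi : MemLp (fun x => g x • F x) 1 (volume.restrict U))
    (hf : ∃ ν, IsDivMeasure U (fun x => f x • F x) ν)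
    (hg : ∃ ν, IsDivMeasure U (fun x => g x • F x) ν) {δ : ℝ} (hδ : 0 < δ)
    (h : ∀ᵐ x ∂volume.restrict U, x ∈ Metric.thickening δ (frontier Ω) → f x = g x) :
    divOn U Ω F f = divOn U Ω F g := by
  obtain ⟨ν, hν⟩ := hf
  obtain ⟨ν', hν'⟩ := hg
  have hgi' : MemLp (fun x => (-1 : ℝ) • g x • F x) 1 (volume.restrict U) :=
    hgi.const_smul (-1 : ℝ)
  have hd := hν.add hfi hgi' (hν'.smul (-1))
  have h0 := hd.apply_eq_zero hU hUb hΩ hΩU hδ (by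
    filter_upwards [h] with x hx hxT
    rw [hx hxT]
    simp)
  rw [hν.divOn_eq hU, hν'.divOn_eq hU]
  have : ν Ω + (-1 : ℝ) • ν' Ω = 0 := h0
  rw [smul_eq_mul] at this
  linarith

/-- Multiplication by the tent function does not change `div(φF)(Ω)`. -/
theorem divOn_tent_mul (hU : IsOpen U) (hUb : Bornology.IsBounded U) (hΩ : MeasurableSet Ω)
    (hΩU : Ω ⊆ U) (hF : MemDM1 U F) {δ : ℝ} (hδ : 0 < δ) (φ : SobolevW1Inf U) :
    divOn U Ω F (fun x => tent (frontier Ω) δ x * φ.toFun x) = divOn U Ω F φ.toFun := by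
  have hφ := hF.exists_isDivMeasure_smul hU hUb φ
  let χ := SobolevW1Inf.ofLipschitz U (tent (frontier Ω) δ) (exists_lipschitzWith_tent _ hδ)
    ⟨1, abs_tent_le _ hδ⟩
  -- The tent multiplies the field `φF`, which already has divergence measure; this avoids forming a
  -- product in `W^{1,∞}`.
  have hχ := MemDM1.exists_isDivMeasure_smul hU hUb ⟨φ.memLp_smul hF.1, hφ⟩ χ
  have hχi := χ.memLp_smul (φ.memLp_smul hF.1)
  simp only [smul_smul] at hχ hχi
  refine divOn_congr hU hUb hΩ hΩU hχi (φ.memLp_smul hF.1) hχ hφ (half_pos hδ)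
    (Eventually.of_forall fun x hx => ?_)
  rw [tent_eq_one _ hx, one_mul]

/-! ### Linear structure of `W^{1,∞}` -/

theorem IsWeakGradient.add (hUb : Bornology.IsBounded U)
    {f f' : EuclideanSpace ℝ (Fin n) → ℝ}
    {g g' : EuclideanSpace ℝ (Fin n) → EuclideanSpace ℝ (Fin n)}
    (hf : MemLp f ∞ (volume.restrict U)) (hg : MemLp g ∞ (volume.restrict U))
    (hf' : MemLp f' ∞ (volume.restrict U)) (hg' : MemLp g' ∞ (volume.restrict U))
    (h : IsWeakGradient U f g) (h' : IsWeakGradient U f' g') :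
    IsWeakGradient U (f + f') (g + g') := by
  intro ψ hψ
  have : IsFiniteMeasure (volume.restrict U) :=
    ⟨by rw [Measure.restrict_apply_univ]; exact hUb.measure_lt_top⟩
  obtain ⟨B, hB⟩ := hψ.exists_abs_le
  obtain ⟨D, hD⟩ := hψ.exists_norm_gradient_le
  have i1 : ∀ p : EuclideanSpace ℝ (Fin n) → ℝ, MemLp p ∞ (volume.restrict U) →
      Integrable (fun x => p x • gradient ψ x) (volume.restrict U) := fun p hp =>
    (hp.integrable le_top).smul_bdd D hψ.continuous_gradient.aestronglyMeasurable
      (Eventually.of_forall hD)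
  have i2 : ∀ p : EuclideanSpace ℝ (Fin n) → EuclideanSpace ℝ (Fin n),
      MemLp p ∞ (volume.restrict U) →
      Integrable (fun x => ψ x • p x) (volume.restrict U) := fun p hp =>
    (hp.integrable le_top).bdd_smul B hψ.continuous.aestronglyMeasurable
      (Eventually.of_forall hB)
  simp only [Pi.add_apply, add_smul, smul_add]
  rw [integral_add (i1 f hf) (i1 f' hf'), integral_add (i2 g hg) (i2 g' hg'), h ψ hψ, h' ψ hψ,
    neg_add]

theorem IsWeakGradient.smul (c : ℝ) {f : EuclideanSpace ℝ (Fin n) → ℝ}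
    {g : EuclideanSpace ℝ (Fin n) → EuclideanSpace ℝ (Fin n)} (h : IsWeakGradient U f g) :
    IsWeakGradient U (c • f) (c • g) := by
  intro ψ hψ
  have h1 : ∀ x, (c • f) x • gradient ψ x = c • (f x • gradient ψ x) := fun x => by
    rw [Pi.smul_apply, smul_assoc]
  have h2 : ∀ x, ψ x • (c • g) x = c • (ψ x • g x) := fun x => by
    rw [Pi.smul_apply, smul_comm]
  simp only [h1, h2]
  rw [integral_smul, integral_smul, h ψ hψ, smul_neg]

/-- Scalar multiples in `W^{1,∞}`. -/
noncomputable def SobolevW1Inf.constSMul (c : ℝ) (φ : SobolevW1Inf U) : SobolevW1Inf U where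
  toFun := c • φ.toFun
  grad := c • φ.grad
  memLp_toFun := φ.memLp_toFun.const_smul c
  memLp_grad := φ.memLp_grad.const_smul c
  isWeakGradient := φ.isWeakGradient.smul c

/-! ### Weighted norms -/

/-- The norm `max ‖f‖_{L^∞(A)} (κ ‖g‖_{L^∞(A)})`. -/
noncomputable def weightedNorm (κ : ℝ≥0∞) (A : Set (EuclideanSpace ℝ (Fin n)))
    (f : EuclideanSpace ℝ (Fin n) → ℝ)
    (g : EuclideanSpace ℝ (Fin n) → EuclideanSpace ℝ (Fin n)) : ℝ≥0∞ :=
  max (eLpNorm f ∞ (volume.restrict A)) (κ * eLpNorm g ∞ (volume.restrict A))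

variable {κ : ℝ≥0∞} {A B : Set (EuclideanSpace ℝ (Fin n))}
  {f f' : EuclideanSpace ℝ (Fin n) → ℝ}
  {g g' : EuclideanSpace ℝ (Fin n) → EuclideanSpace ℝ (Fin n)}

theorem weightedNorm_mono (h : A ⊆ B) : weightedNorm κ A f g ≤ weightedNorm κ B f g := by
  have := Measure.restrict_mono h (le_refl (volume : Measure (EuclideanSpace ℝ (Fin n))))
  exact max_le_max (eLpNorm_mono_measure _ this)
    (mul_le_mul_right (eLpNorm_mono_measure _ this) _)

theorem weightedNorm_ne_top (hκ : κ ≠ ⊤) (hA : A ⊆ U) (hf : MemLp f ∞ (volume.restrict U))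
    (hg : MemLp g ∞ (volume.restrict U)) : weightedNorm κ A f g ≠ ⊤ :=
  ne_top_of_le_ne_top (max_lt hf.2 (ENNReal.mul_lt_top hκ.lt_top hg.2)).ne (weightedNorm_mono hA)

theorem weightedNorm_add_le (hf : AEStronglyMeasurable f (volume.restrict A))
    (hf' : AEStronglyMeasurable f' (volume.restrict A))
    (hg : AEStronglyMeasurable g (volume.restrict A))
    (hg' : AEStronglyMeasurable g' (volume.restrict A)) :
    weightedNorm κ A (f + f') (g + g') ≤ weightedNorm κ A f g + weightedNorm κ A f' g' := by
  refine max_le ?_ ?_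
  · exact (eLpNorm_add_le hf hf' le_top).trans (add_le_add (le_max_left _ _) (le_max_left _ _))
  · refine (mul_le_mul_right (eLpNorm_add_le hg hg' le_top) κ).trans ?_
    rw [mul_add]
    exact add_le_add (le_max_right _ _) (le_max_right _ _)

theorem weightedNorm_smul (c : ℝ) :
    weightedNorm κ A (c • f) (c • g) = ‖c‖ₑ * weightedNorm κ A f g := by
  rw [weightedNorm, eLpNorm_const_smul, eLpNorm_const_smul, mul_left_comm, weightedNorm]
  exact (mul_max_of_nonneg _ _ zero_le).symm

theorem weightedNorm_eq_zero (hf : f =ᵐ[volume.restrict A] 0) (hg : g =ᵐ[volume.restrict A] 0) :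
    weightedNorm κ A f g = 0 := by
  rw [weightedNorm, eLpNorm_congr_ae hf, eLpNorm_congr_ae hg]
  simp

/-- The supremum of `div(φF)(Ω)` over the unit ball of the weighted norm on `(∂Ω)_δ ∩ U`. -/
noncomputable def weightedTraceBound (κ : ℝ≥0∞) (U Ω : Set (EuclideanSpace ℝ (Fin n)))
    (F : EuclideanSpace ℝ (Fin n) → EuclideanSpace ℝ (Fin n)) (δ : ℝ) : EReal :=
  ⨆ (φ : SobolevW1Inf U) (_ : weightedNorm κ (bdryNhd U Ω δ) φ.toFun φ.grad ≤ 1),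
    (divOn U Ω F φ.toFun : EReal)

theorem supTraceBound_eq (δ : ℝ) : supTraceBound U Ω F δ = weightedTraceBound 0 U Ω F δ := by
  simp [supTraceBound, weightedTraceBound, SobolevW1Inf.supNormOn, weightedNorm, divOn]

theorem tentTraceBound_eq (hU : IsOpen U) (hUb : Bornology.IsBounded U) (hΩ : MeasurableSet Ω)
    (hΩU : Ω ⊆ U) (hF : MemDM1 U F) {δ : ℝ} (hδ : 0 < δ) :
    tentTraceBound U Ω F δ = weightedTraceBound 1 U Ω F δ := by
  simp only [tentTraceBound, weightedTraceBound, SobolevW1Inf.normOn, weightedNorm, one_mul]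
  refine iSup_congr fun φ => iSup_congr fun _ => ?_
  rw [← divOn_tent_mul hU hUb hΩ hΩU hF hδ φ]
  rfl

theorem bdryNhd_mono {δ δ' : ℝ} (h : δ ≤ δ') : bdryNhd U Ω δ ⊆ bdryNhd U Ω δ' :=
  inter_subset_inter_left _ (Metric.thickening_mono h _)

theorem weightedTraceBound_antitone : Antitone (weightedTraceBound κ U Ω F) := fun _ _ h =>
  iSup₂_le fun φ hφ => le_iSup₂_of_le φ ((weightedNorm_mono (bdryNhd_mono h)).trans hφ) le_rfl

/-- Homogeneity. Since the seminorm of `φ` may be zero, `φ` is divided by numbers `t` above it, and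
then `t` decreases to it. -/
theorem divOn_le_of_weightedTraceBound_le (hU : IsOpen U) (hUb : Bornology.IsBounded U)
    (hF : MemDM1 U F) (hκ : κ ≠ ⊤) {δ C : ℝ}
    (h : weightedTraceBound κ U Ω F δ ≤ C) (φ : SobolevW1Inf U) :
    divOn U Ω F φ.toFun ≤ C * (weightedNorm κ (bdryNhd U Ω δ) φ.toFun φ.grad).toReal := by
  set w := weightedNorm κ (bdryNhd U Ω δ) φ.toFun φ.grad with hw
  have hwt : w ≠ ⊤ := weightedNorm_ne_top hκ inter_subset_right φ.memLp_toFun φ.memLp_grad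
  have key : ∀ t : ℝ, w.toReal < t → divOn U Ω F φ.toFun ≤ C * t := by
    intro t ht
    have ht0 : 0 < t := ENNReal.toReal_nonneg.trans_lt ht
    have h1 : weightedNorm κ (bdryNhd U Ω δ) (φ.constSMul t⁻¹).toFun (φ.constSMul t⁻¹).grad ≤ 1 := by
      change weightedNorm κ (bdryNhd U Ω δ) (t⁻¹ • φ.toFun) (t⁻¹ • φ.grad) ≤ 1
      rw [weightedNorm_smul, ← hw, ← ENNReal.ofReal_toReal hwt,
        Real.enorm_of_nonneg (inv_nonneg.2 ht0.le), ← ENNReal.ofReal_mul (inv_nonneg.2 ht0.le),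
        ← ENNReal.ofReal_one]
      refine ENNReal.ofReal_le_ofReal ?_
      rw [inv_mul_le_one₀ ht0]
      exact ht.le
    have h2 := (le_iSup₂_of_le (f := fun (φ : SobolevW1Inf U)
      (_ : weightedNorm κ (bdryNhd U Ω δ) φ.toFun φ.grad ≤ 1) =>
        (divOn U Ω F φ.toFun : EReal)) (φ.constSMul t⁻¹) h1 le_rfl).trans h
    have h3 : divOn U Ω F (t⁻¹ • φ.toFun) ≤ C := EReal.coe_le_coe_iff.1 h2
    rw [divOn_smul hU hUb hF, inv_mul_le_iff₀ ht0] at h3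
    linarith
  have hlim : Tendsto (fun t : ℝ => C * t) (𝓝[>] w.toReal) (𝓝 (C * w.toReal)) :=
    (tendsto_id.const_mul C).mono_left nhdsWithin_le_nhds
  exact ge_of_tendsto hlim (eventually_mem_nhdsWithin.mono fun t ht => key t ht)

theorem exists_le_of_weightedTraceBound_lt_top {δ : ℝ} (h : weightedTraceBound κ U Ω F δ < ⊤) :
    ∃ C : ℝ, 0 ≤ C ∧ weightedTraceBound κ U Ω F δ ≤ C := by
  refine ⟨max 0 (weightedTraceBound κ U Ω F δ).toReal, le_max_left _ _, ?_⟩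
  refine (EReal.le_coe_toReal h.ne).trans ?_
  exact_mod_cast le_max_right _ _

/-- Every `δ` has a smaller `δ'` at which the bound stays below a fixed `c`, and antitonicity
carries this to `δ`. -/
theorem exists_le_of_liminf_lt_top
    (h : liminf (fun δ : ℝ => weightedTraceBound κ U Ω F δ) (𝓝[>] 0) < ⊤) :
    ∃ C : ℝ, 0 ≤ C ∧ ∀ δ, 0 < δ → weightedTraceBound κ U Ω F δ ≤ C := by
  obtain ⟨c, hc, hct⟩ := exists_between h
  have hfreq := frequently_lt_of_liminf_lt (by isBoundedDefault) hc
  refine ⟨max 0 c.toReal, le_max_left _ _, fun δ hδ => ?_⟩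
  obtain ⟨δ', hδ', hlt⟩ := (hfreq.and_eventually (Ioo_mem_nhdsGT hδ)).exists
  refine (weightedTraceBound_antitone hlt.2.le).trans (hδ'.le.trans ?_)
  refine (EReal.le_coe_toReal hct.ne).trans ?_
  exact_mod_cast le_max_right _ _

end DivOn

/-! ### Normal traces from bounds -/

section Traces

variable {n : ℕ} {U Ω : Set (EuclideanSpace ℝ (Fin n))}
  {F : EuclideanSpace ℝ (Fin n) → EuclideanSpace ℝ (Fin n)} {κ : ℝ≥0∞}

/-- The pairs of essentially bounded functions and fields. -/
def boundedPairs (U : Set (EuclideanSpace ℝ (Fin n))) :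
    Submodule ℝ ((EuclideanSpace ℝ (Fin n) → ℝ) ×
      (EuclideanSpace ℝ (Fin n) → EuclideanSpace ℝ (Fin n))) where
  carrier := {p | MemLp p.1 ∞ (volume.restrict U) ∧ MemLp p.2 ∞ (volume.restrict U)}
  add_mem' hp hq := ⟨hp.1.add hq.1, hp.2.add hq.2⟩
  zero_mem' := ⟨MemLp.zero, MemLp.zero⟩
  smul_mem' c _ hp := ⟨hp.1.const_smul c, hp.2.const_smul c⟩

/-- The pairs consisting of a Sobolev function and its weak gradient. -/
def sobolevPairs (U : Set (EuclideanSpace ℝ (Fin n))) (hUb : Bornology.IsBounded U) :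
    Submodule ℝ (boundedPairs U) where
  carrier := {p | IsWeakGradient U p.1.1 p.1.2}
  add_mem' {p q} hp hq := IsWeakGradient.add hUb p.2.1 p.2.2 q.2.1 q.2.2 hp hq
  zero_mem' ψ _ := by simp
  smul_mem' c _ hp := IsWeakGradient.smul c hp

/-- The Sobolev function of a pair. -/
def sobolevPairs.toSobolev {hUb : Bornology.IsBounded U} (p : sobolevPairs U hUb) :
    SobolevW1Inf U :=
  ⟨p.1.1.1, p.1.1.2, p.1.2.1, p.1.2.2, p.2⟩

/-- Hahn-Banach extension of `φ ↦ div(φF)(Ω)`. -/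
theorem exists_extension_divOn (hU : IsOpen U) (hUb : Bornology.IsBounded U) (hF : MemDM1 U F)
    (hκ : κ ≠ ⊤) {ι : Type*} [Nonempty ι] {A : ι → Set (EuclideanSpace ℝ (Fin n))}
    (hA : ∀ i, A i ⊆ U) (hdir : ∀ i j, ∃ k, A k ⊆ A i ∧ A k ⊆ A j) {C : ℝ} (hC : 0 ≤ C)
    (hT : ∀ i (φ : SobolevW1Inf U),
      divOn U Ω F φ.toFun ≤ C * (weightedNorm κ (A i) φ.toFun φ.grad).toReal) :
    ∃ ℓ : ((EuclideanSpace ℝ (Fin n) → ℝ) ×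
        (EuclideanSpace ℝ (Fin n) → EuclideanSpace ℝ (Fin n))) →ₗ[ℝ] ℝ,
      (∀ φ : SobolevW1Inf U, ℓ (φ.toFun, φ.grad) = divOn U Ω F φ.toFun) ∧
      ∀ i f g, MemLp f ∞ (volume.restrict U) → MemLp g ∞ (volume.restrict U) →
        |ℓ (f, g)| ≤ C * (weightedNorm κ (A i) f g).toReal := by
  let q : ι → boundedPairs U → ℝ := fun i p => (weightedNorm κ (A i) p.1.1 p.1.2).toReal
  have hq0 : ∀ i p, 0 ≤ q i p := fun i p => ENNReal.toReal_nonneg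
  have hbdd : ∀ p, BddBelow (range fun i => q i p) := fun p =>
    ⟨0, by rintro _ ⟨i, rfl⟩; exact hq0 i p⟩
  have hfin : ∀ i (p : boundedPairs U), weightedNorm κ (A i) p.1.1 p.1.2 ≠ ⊤ := fun i p =>
    weightedNorm_ne_top hκ (hA i) p.2.1 p.2.2
  have hqmono : ∀ i j p, A i ⊆ A j → q i p ≤ q j p := fun i j p h =>
    ENNReal.toReal_mono (hfin j p) (weightedNorm_mono h)
  have hqadd : ∀ i (p r : boundedPairs U), q i (p + r) ≤ q i p + q i r := fun i p r => by
    have hm := Measure.restrict_mono (hA i) (le_refl (volume : Measure (EuclideanSpace ℝ (Fin n))))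
    refine (ENNReal.toReal_mono (ENNReal.add_ne_top.2 ⟨hfin i p, hfin i r⟩)
      (weightedNorm_add_le (p.2.1.1.mono_measure hm) (r.2.1.1.mono_measure hm)
        (p.2.2.1.mono_measure hm) (r.2.2.1.mono_measure hm))).trans_eq ?_
    exact ENNReal.toReal_add (hfin i p) (hfin i r)
  have hqsmul : ∀ i (c : ℝ) (p : boundedPairs U), q i (c • p) = |c| * q i p := fun i c p => by
    change (weightedNorm κ (A i) (c • p.1.1) (c • p.1.2)).toReal = _
    rw [weightedNorm_smul, ENNReal.toReal_mul, toReal_enorm, Real.norm_eq_abs]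
  let T : boundedPairs U →ₗ.[ℝ] ℝ :=
    { domain := sobolevPairs U hUb
      toFun :=
        { toFun := fun p => divOn U Ω F (sobolevPairs.toSobolev p).toFun
          map_add' := fun p r => divOn_add hU hUb hF (sobolevPairs.toSobolev p) (sobolevPairs.toSobolev r)
          map_smul' := fun c p => divOn_smul hU hUb hF c (sobolevPairs.toSobolev p) } }
  have hN₁ : ∀ c : ℝ, 0 < c → ∀ p, C * ⨅ i, q i (c • p) = c * (C * ⨅ i, q i p) := by
    intro c hc p
    simp only [hqsmul, abs_of_pos hc]
    rw [← Real.mul_iInf_of_nonneg hc.le]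
    ring
  -- Directedness enters here: a set inside both `A i` and `A j` bounds the seminorm of a sum by `q
  -- i p + q j r`.
  have hN₂ : ∀ p r, C * ⨅ i, q i (p + r) ≤ (C * ⨅ i, q i p) + C * ⨅ i, q i r := by
    intro p r
    rw [← mul_add]
    refine mul_le_mul_of_nonneg_left (le_ciInf_add_ciInf fun i j => ?_) hC
    obtain ⟨k, hki, hkj⟩ := hdir i j
    exact (ciInf_le (hbdd _) k).trans ((hqadd k p r).trans
      (add_le_add (hqmono k i p hki) (hqmono k j r hkj)))
  have hTN : ∀ p : T.domain, T p ≤ C * ⨅ i, q i p := by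
    rintro ⟨p, hp⟩
    rw [Real.mul_iInf_of_nonneg hC]
    exact le_ciInf fun i => hT i (sobolevPairs.toSobolev ⟨p, hp⟩)
  obtain ⟨e, heT, heN⟩ := exists_extension_of_le_sublinear T
    (fun p => C * ⨅ i, q i p) hN₁ hN₂ hTN
  -- A purely algebraic extension to all pairs of functions, for convenience; the bounds are claimed
  -- only for essentially bounded pairs.
  obtain ⟨ℓ, hℓ⟩ := e.exists_extend
  have hℓe : ∀ p : boundedPairs U, ℓ p.1 = e p := fun p => LinearMap.congr_fun hℓ p
  have hle : ∀ i p, e p ≤ C * q i p := fun i p =>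
    (heN p).trans (mul_le_mul_of_nonneg_left (ciInf_le (hbdd p) i) hC)
  refine ⟨ℓ, fun φ => ?_, fun i f g hf hg => ?_⟩
  · rw [hℓe ⟨(φ.toFun, φ.grad), φ.memLp_toFun, φ.memLp_grad⟩]
    exact heT ⟨⟨(φ.toFun, φ.grad), φ.memLp_toFun, φ.memLp_grad⟩, φ.isWeakGradient⟩
  · let p : boundedPairs U := ⟨(f, g), hf, hg⟩
    rw [hℓe p]
    refine abs_le'.2 ⟨hle i p, ?_⟩
    have := hle i ((-1 : ℝ) • p)
    rw [hqsmul, map_smul] at this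
    simpa using this

/-- A bound for `div(φF)(Ω)` by the weighted norms on a directed family of sets yields measures,
concentrated on each of these sets, that represent `div(φF)(Ω)`. -/
theorem exists_gaussGreenOn (hU : IsOpen U) (hUb : Bornology.IsBounded U) (hF : MemDM1 U F)
    (hκ : κ ≠ ⊤) {ι : Type*} [Nonempty ι] {A : ι → Set (EuclideanSpace ℝ (Fin n))}
    (hAm : ∀ i, MeasurableSet (A i))
    (hA : ∀ i, A i ⊆ U) (hdir : ∀ i j, ∃ k, A k ⊆ A i ∧ A k ⊆ A j) {C : ℝ} (hC : 0 ≤ C)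
    (hT : ∀ i (φ : SobolevW1Inf U),
      divOn U Ω F φ.toFun ≤ C * (weightedNorm κ (A i) φ.toFun φ.grad).toReal) :
    ∃ (lam : BddAddMeasure (volume.restrict U) ℝ)
      (μ : BddAddMeasure (volume.restrict U) (EuclideanSpace ℝ (Fin n))),
      (κ = 0 → μ = 0) ∧ (∀ i, lam.core ⊆ closure (A i)) ∧ (∀ i, μ.core ⊆ closure (A i)) ∧
        ∀ i, GaussGreenOn Ω F (A i) lam μ := by
  obtain ⟨ℓ, hℓT, hℓb⟩ := exists_extension_divOn hU hUb hF hκ hA hdir hC hT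
  obtain ⟨i₀⟩ := ‹Nonempty ι›
  set σ := (volume : Measure (EuclideanSpace ℝ (Fin n))).restrict U with hσ
  have hone : ∀ j : Fin n, ‖(EuclideanSpace.single j (1 : ℝ) : EuclideanSpace ℝ (Fin n))‖ = 1 :=
    fun j => by simp
  let ℓ₀ : (EuclideanSpace ℝ (Fin n) → ℝ) →ₗ[ℝ] ℝ := ℓ ∘ₗ LinearMap.inl ℝ _ _
  let E : Fin n → (EuclideanSpace ℝ (Fin n) → ℝ) →ₗ[ℝ]
      (EuclideanSpace ℝ (Fin n) → EuclideanSpace ℝ (Fin n)) := fun j =>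
    { toFun := fun f x => f x • EuclideanSpace.single j 1
      map_add' := fun f g => funext fun x => add_smul _ _ _
      map_smul' := fun c f => funext fun x => smul_assoc c (f x) (EuclideanSpace.single j (1 : ℝ)) }
  let ℓ₁ : Fin n → (EuclideanSpace ℝ (Fin n) → ℝ) →ₗ[ℝ] ℝ := fun j =>
    ℓ ∘ₗ LinearMap.inr ℝ _ _ ∘ₗ E j
  have hE : ∀ j f, MemLp f ∞ σ → MemLp (E j f) ∞ σ := fun j f hf => by
    refine hf.mono (hf.1.smul_const _) (Eventually.of_forall fun x => ?_)
    change ‖f x • EuclideanSpace.single j (1 : ℝ)‖ ≤ _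
    rw [norm_smul, hone, mul_one]
  have hEn : ∀ j f (S : Set (EuclideanSpace ℝ (Fin n))),
      eLpNorm (E j f) ∞ (volume.restrict S) = eLpNorm f ∞ (volume.restrict S) := fun j f S => by
    refine eLpNorm_congr_norm_ae (Eventually.of_forall fun x => ?_)
    change ‖f x • EuclideanSpace.single j (1 : ℝ)‖ = _
    rw [norm_smul, hone, mul_one]
  have hb₀ : ∀ f, MemLp f ∞ σ → |ℓ₀ f| ≤ C * (eLpNorm f ∞ σ).toReal := fun f hf => by
    refine (hℓb i₀ f 0 hf MemLp.zero).trans (mul_le_mul_of_nonneg_left ?_ hC)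
    refine ENNReal.toReal_mono hf.2.ne ((weightedNorm_mono (hA i₀)).trans_eq ?_)
    simp [weightedNorm, hσ]
  have hb₁ : ∀ j f, MemLp f ∞ σ → |ℓ₁ j f| ≤ (C * κ.toReal) * (eLpNorm f ∞ σ).toReal :=
    fun j f hf => by
    refine (hℓb i₀ 0 (E j f) MemLp.zero (hE j f hf)).trans ?_
    rw [mul_assoc, ← ENNReal.toReal_mul]
    refine mul_le_mul_of_nonneg_left ?_ hC
    refine ENNReal.toReal_mono (ENNReal.mul_ne_top hκ hf.2.ne)
      ((weightedNorm_mono (hA i₀)).trans_eq ?_)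
    rw [weightedNorm, hEn]
    simp [hσ]
  -- The functional sees only values on `A i`. This locates the cores and allows `φ` and `Dφ` to be
  -- cut off outside `A i`.
  have hvanish : ∀ i f g, MemLp f ∞ σ → MemLp g ∞ σ → (∀ x ∈ A i, f x = 0) →
      (∀ x ∈ A i, g x = 0) → ℓ (f, g) = 0 := by
    intro i f g hf hg hf0 hg0
    have := hℓb i f g hf hg
    rw [weightedNorm_eq_zero (ae_restrict_of_forall_mem (hAm i) hf0)
      (ae_restrict_of_forall_mem (hAm i) hg0), ENNReal.toReal_zero, mul_zero] at this
    exact abs_eq_zero.1 (le_antisymm this (abs_nonneg _))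
  have hind : ∀ B : Set (EuclideanSpace ℝ (Fin n)), MeasurableSet B →
      MemLp (B.indicator (1 : EuclideanSpace ℝ (Fin n) → ℝ)) ∞ σ := fun B hB =>
    memLp_top_of_bound
      (stronglyMeasurable_const (b := (1 : ℝ)) |>.indicator hB).aestronglyMeasurable 1
      (Eventually.of_forall fun x => by by_cases hx : x ∈ B <;> simp [hx])
  let lam := BddAddMeasure.ofFunctional σ ℓ₀ C hb₀
  let m : Fin n → BddAddMeasure σ ℝ := fun j =>
    BddAddMeasure.ofFunctional σ (ℓ₁ j) (C * κ.toReal) (hb₁ j)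
  refine ⟨lam, BddAddMeasure.ofComponents m, fun hκ0 => ?_, fun i => ?_, fun i => ?_,
    fun i φ => ?_⟩
  · refine BddAddMeasure.ofComponents_eq_zero fun j => BddAddMeasure.ofFunctional_eq_zero
      fun f hf => abs_eq_zero.1 (le_antisymm ?_ (abs_nonneg _))
    have := hb₁ j f hf
    rwa [hκ0, ENNReal.toReal_zero, mul_zero, zero_mul] at this
  · refine BddAddMeasure.core_subset_closure fun B hB hBA => ?_
    rw [BddAddMeasure.ofFunctional_apply hB]
    exact hvanish i _ 0 (hind B hB) MemLp.zero
      (fun x hx => indicator_of_notMem (fun hxB => disjoint_left.1 hBA hxB hx) _) fun x _ => rfl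
  · refine BddAddMeasure.core_subset_closure fun B hB hBA => ?_
    ext j
    change (m j).toFun B = 0
    rw [BddAddMeasure.ofFunctional_apply hB]
    refine hvanish i 0 _ MemLp.zero (hE j _ (hind B hB)) (fun x _ => rfl) fun x hx => ?_
    change B.indicator (1 : EuclideanSpace ℝ (Fin n) → ℝ) x • EuclideanSpace.single j (1 : ℝ) = 0
    rw [indicator_of_notMem fun hxB => disjoint_left.1 hBA hxB hx, zero_smul]
  · have hφA : MemLp ((A i).indicator φ.toFun) ∞ σ := φ.memLp_toFun.indicator (hAm i)
    have hgA : MemLp ((A i).indicator φ.grad) ∞ σ := φ.memLp_grad.indicator (hAm i)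
    have hgj : ∀ j, MemLp ((A i).indicator fun x => φ.grad x j) ∞ σ := fun j =>
      MemLp.indicator (hAm i) (φ.memLp_grad.mono
        ((EuclideanSpace.proj (𝕜 := ℝ) j).continuous.comp_aestronglyMeasurable φ.memLp_grad.1)
        (Eventually.of_forall fun x => PiLp.norm_apply_le (φ.grad x) j))
    have h1 : lam.setIntegral (A i) φ.toFun = ℓ ((A i).indicator φ.toFun, 0) :=
      (BddAddMeasure.hasIntegral_ofFunctional hφA).integral_eq
    have h2 : ∀ j, ((BddAddMeasure.ofComponents m).component j).setIntegral (A i)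
        (fun x => φ.grad x j) = ℓ (0, E j ((A i).indicator fun x => φ.grad x j)) := fun j =>
      (BddAddMeasure.hasIntegral_ofFunctional (hℓ := hb₁ j) (hgj j)).integral_eq
    have h3 : (A i).indicator φ.grad = ∑ j, E j ((A i).indicator fun x => φ.grad x j) := by
      ext x k
      rw [Finset.sum_apply]
      simp only [WithLp.ofLp_sum, Finset.sum_apply]
      rw [Finset.sum_eq_single k]
      · by_cases hx : x ∈ A i <;> simp [E, hx]
      · intro j _ hj
        simp [E, hj.symm]
      · simp
    have h4 : ℓ (φ.toFun, φ.grad) = ℓ ((A i).indicator φ.toFun, (A i).indicator φ.grad) := by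
      rw [← sub_eq_zero, ← map_sub]
      exact hvanish i _ _ (φ.memLp_toFun.sub hφA) (φ.memLp_grad.sub hgA)
        (fun x hx => by simp [hx]) fun x hx => by simp [hx]
    have h5 : ((A i).indicator φ.toFun, (A i).indicator φ.grad) =
        ((A i).indicator φ.toFun, (0 : EuclideanSpace ℝ (Fin n) → EuclideanSpace ℝ (Fin n))) +
          ∑ j, ((0 : EuclideanSpace ℝ (Fin n) → ℝ), E j ((A i).indicator fun x => φ.grad x j)) := by
      refine Prod.ext ?_ ?_
      · simp [Prod.fst_sum]
      · rw [h3]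
        simp [Prod.snd_sum]
    change divOn U Ω F φ.toFun = _
    rw [← hℓT φ, h4, h5, map_add, map_sum, h1, BddAddMeasure.setIntegralVec]
    simp only [h2]

end Traces

/-! ### Bounds from normal traces -/

section Bounds

variable {n : ℕ} {U Ω A : Set (EuclideanSpace ℝ (Fin n))}
  {F : EuclideanSpace ℝ (Fin n) → EuclideanSpace ℝ (Fin n)}
  {lam : BddAddMeasure (volume.restrict U) ℝ}
  {μ : BddAddMeasure (volume.restrict U) (EuclideanSpace ℝ (Fin n))}

theorem measurableSet_bdryNhd (hU : IsOpen U) (δ : ℝ) : MeasurableSet (bdryNhd U Ω δ) :=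
  (Metric.isOpen_thickening.inter hU).measurableSet

namespace BddAddMeasure

theorem setIntegral_le (lam : BddAddMeasure (volume.restrict U) ℝ) (hA : MeasurableSet A)
    {f : EuclideanSpace ℝ (Fin n) → ℝ} (hf : AEStronglyMeasurable f (volume.restrict U))
    (h : eLpNorm f ∞ (volume.restrict A) ≤ 1) : lam.setIntegral A f ≤ lam.variationReal univ := by
  have hb := ae_norm_le_toReal_eLpNorm_top (h.trans_lt ENNReal.one_lt_top).ne
  rw [ae_restrict_iff' hA] at hb
  refine (le_abs_self _).trans ((lam.abs_integral_le (hf.indicator hA) zero_le_one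
    (ae_restrict_of_ae ?_)).trans_eq (one_mul _))
  filter_upwards [hb] with x hx
  by_cases hxA : x ∈ A
  · rw [indicator_of_mem hxA]
    exact (hx hxA).trans (ENNReal.toReal_mono ENNReal.one_ne_top h)
  · simp [hxA]

theorem setIntegralVec_le (μ : BddAddMeasure (volume.restrict U) (EuclideanSpace ℝ (Fin n)))
    (hA : MeasurableSet A) {g : EuclideanSpace ℝ (Fin n) → EuclideanSpace ℝ (Fin n)}
    (hg : AEStronglyMeasurable g (volume.restrict U))
    (h : eLpNorm g ∞ (volume.restrict A) ≤ 1) :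
    μ.setIntegralVec A g ≤ ∑ j, (μ.component j).variationReal univ :=
  Finset.sum_le_sum fun j _ => setIntegral_le _ hA
    ((EuclideanSpace.proj (𝕜 := ℝ) j).continuous.comp_aestronglyMeasurable hg)
    ((eLpNorm_mono fun x => PiLp.norm_apply_le (g x) j).trans h)

theorem setIntegralVec_zero (hA : MeasurableSet A)
    {g : EuclideanSpace ℝ (Fin n) → EuclideanSpace ℝ (Fin n)}
    (hg : MemLp g ∞ (volume.restrict U)) :
    (0 : BddAddMeasure (volume.restrict U) (EuclideanSpace ℝ (Fin n))).setIntegralVec A g = 0 := by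
  refine Finset.sum_eq_zero fun j _ => abs_eq_zero.1 (le_antisymm ?_ (abs_nonneg _))
  have hgj : MemLp (A.indicator fun x => g x j) ∞ (volume.restrict U) :=
    MemLp.indicator hA (hg.mono
      ((EuclideanSpace.proj (𝕜 := ℝ) j).continuous.comp_aestronglyMeasurable hg.1)
      (Eventually.of_forall fun x => PiLp.norm_apply_le (g x) j))
  refine (abs_integral_le _ hgj.1 ENNReal.toReal_nonneg
    (ae_norm_le_toReal_eLpNorm_top hgj.2.ne)).trans_eq ?_
  rw [variationReal, totalVariation_eq_zero_of_forall _ fun B _ _ => rfl, ENNReal.toReal_zero,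
    mul_zero]

/-- The integral does not depend on the open set as long as the measure is concentrated on it. -/
theorem setIntegral_eq_of_totalVariation {μ : BddAddMeasure (volume.restrict U) ℝ}
    {V W : Set (EuclideanSpace ℝ (Fin n))} (hU : IsOpen U) (hV : IsOpen V) (hW : IsOpen W)
    (h : μ.totalVariation (V ∩ W ∩ U)ᶜ = 0) (f : EuclideanSpace ℝ (Fin n) → ℝ) :
    μ.setIntegral (V ∩ U) f = μ.setIntegral (W ∩ U) f := by
  refine μ.integral_congr ((hV.inter hW).inter hU).measurableSet.compl h fun x hx => ?_
  obtain ⟨⟨hxV, hxW⟩, hxU⟩ := not_not.1 hx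
  rw [indicator_of_mem (mem_inter hxV hxU), indicator_of_mem (mem_inter hxW hxU)]

end BddAddMeasure

theorem weightedTraceBound_one_le (hU : IsOpen U) {δ : ℝ}
    (h : GaussGreenOn Ω F (bdryNhd U Ω δ) lam μ) :
    weightedTraceBound 1 U Ω F δ ≤
      ((lam.variationReal univ + ∑ j, (μ.component j).variationReal univ : ℝ) : EReal) := by
  refine iSup₂_le fun φ hφ => EReal.coe_le_coe_iff.2 ?_
  rw [weightedNorm, one_mul, max_le_iff] at hφ
  exact (h φ).trans_le (add_le_add
    (lam.setIntegral_le (measurableSet_bdryNhd hU δ) φ.memLp_toFun.1 hφ.1)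
    (μ.setIntegralVec_le (measurableSet_bdryNhd hU δ) φ.memLp_grad.1 hφ.2))

theorem weightedTraceBound_zero_le (hU : IsOpen U) {δ : ℝ}
    (h : GaussGreenOn Ω F (bdryNhd U Ω δ) lam 0) :
    weightedTraceBound 0 U Ω F δ ≤ (lam.variationReal univ : EReal) := by
  refine iSup₂_le fun φ hφ => EReal.coe_le_coe_iff.2 ?_
  have hT := h φ
  rw [BddAddMeasure.setIntegralVec_zero (measurableSet_bdryNhd hU δ) φ.memLp_grad, add_zero] at hT
  exact hT.trans_le (lam.setIntegral_le (measurableSet_bdryNhd hU δ) φ.memLp_toFun.1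
    ((le_max_left _ _).trans hφ))

theorem liminf_lt_top_of_le {u : ℝ → EReal} {C : ℝ} (h : ∀ δ, 0 < δ → u δ ≤ C) :
    liminf u (𝓝[>] 0) < ⊤ :=
  (liminf_le_of_le (by isBoundedDefault) fun b hb => by
    obtain ⟨δ, hδb, hδ⟩ := (hb.and self_mem_nhdsWithin).exists
    exact hδb.trans (h δ hδ)).trans_lt (EReal.coe_lt_top C)

/-- Both measures are concentrated on `(∂Ω)_δ ∩ W ∩ U`, a neighbourhood of their cores within `U`,
so integrating over `(∂Ω)_δ ∩ U` or over `W ∩ U` gives the same value. -/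
theorem IsNormalTrace.gaussGreenOn (hU : IsOpen U) (hUb : Bornology.IsBounded U)
    (hlam : lam.core ⊆ frontier Ω) (hμ : μ.core ⊆ frontier Ω) {δ : ℝ} (hδ : 0 < δ)
    (h : IsNormalTrace Ω F δ lam μ) {W : Set (EuclideanSpace ℝ (Fin n))} (hW : IsOpen W)
    (hΩW : frontier Ω ⊆ W) : GaussGreenOn Ω F (W ∩ U) lam μ := by
  have hV : IsOpen (Metric.thickening δ (frontier Ω)) := Metric.isOpen_thickening
  have hsub : frontier Ω ⊆ Metric.thickening δ (frontier Ω) ∩ W :=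
    subset_inter (Metric.self_subset_thickening hδ _) hΩW
  have h₁ := BddAddMeasure.totalVariation_compl_eq_zero hU.measurableSet hUb (hV.inter hW)
    (hlam.trans hsub)
  have h₂ := fun j => le_antisymm ((μ.totalVariation_component_le j _).trans_eq
    (BddAddMeasure.totalVariation_compl_eq_zero hU.measurableSet hUb (hV.inter hW)
      (hμ.trans hsub))) zero_le
  intro φ
  rw [h.2.2 φ, bdryNhd, BddAddMeasure.setIntegral_eq_of_totalVariation hU hV hW h₁]
  congr 1
  exact Finset.sum_congr rfl fun j _ =>
    BddAddMeasure.setIntegral_eq_of_totalVariation hU hV hW (h₂ j) _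

/-- Uniform bounds yield measures with core in the boundary that form a normal trace for every
neighbourhood. -/
theorem exists_isNormalTrace_of_bound (hU : IsOpen U) (hUb : Bornology.IsBounded U)
    (hF : MemDM1 U F) {κ : ℝ≥0∞} (hκ : κ ≠ ⊤) {C : ℝ} (hC : 0 ≤ C)
    (h : ∀ δ, 0 < δ → weightedTraceBound κ U Ω F δ ≤ C) :
    ∃ (lam : BddAddMeasure (volume.restrict U) ℝ)
      (μ : BddAddMeasure (volume.restrict U) (EuclideanSpace ℝ (Fin n))),
      (κ = 0 → μ = 0) ∧ lam.core ⊆ frontier Ω ∧ μ.core ⊆ frontier Ω ∧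
        ∀ δ, 0 < δ → IsNormalTrace Ω F δ lam μ := by
  have : Nonempty (Ioi (0 : ℝ)) := ⟨⟨1, mem_Ioi.2 one_pos⟩⟩
  obtain ⟨lam, μ, h0, hl, hm, hG⟩ := exists_gaussGreenOn (ι := Ioi (0 : ℝ)) hU hUb hF hκ
    (A := fun δ => bdryNhd U Ω δ) (fun δ => measurableSet_bdryNhd hU δ)
    (fun δ => inter_subset_right)
    (fun δ ε => ⟨δ ⊓ ε, bdryNhd_mono inf_le_left, bdryNhd_mono inf_le_right⟩) hC
    fun δ φ => divOn_le_of_weightedTraceBound_le hU hUb hF hκ (h δ δ.2) φ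
  -- The frontier is closed, hence the intersection of its closed `δ`-neighbourhoods.
  have key : ∀ S : Set (EuclideanSpace ℝ (Fin n)),
      (∀ δ : Ioi (0 : ℝ), S ⊆ closure (bdryNhd U Ω δ)) → S ⊆ frontier Ω := fun S hS => by
    rw [← isClosed_frontier.closure_eq, Metric.closure_eq_iInter_cthickening]
    exact subset_iInter₂ fun δ hδ => (hS ⟨δ, hδ⟩).trans ((closure_mono inter_subset_left).trans
      (Metric.closure_thickening_subset_cthickening δ _))
  exact ⟨lam, μ, h0, key _ hl, key _ hm, fun δ hδ =>
    ⟨hl ⟨δ, hδ⟩, hm ⟨δ, hδ⟩, hG ⟨δ, hδ⟩⟩⟩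

end Bounds

/-! ### The characterisations of normal traces -/

theorem mainTheorem4 {n : ℕ} (U Ω : Set (EuclideanSpace ℝ (Fin n)))
    (F : EuclideanSpace ℝ (Fin n) → EuclideanSpace ℝ (Fin n))
    (hUo : IsOpen U) (hUb : Bornology.IsBounded U)
    (hΩ : MeasurableSet Ω) (hΩU : Ω ⊆ U) (hF : MemDM1 U F) :
    -- (1) measures with core in the boundary, and the form of the formula in this case
    (((∃ (lam : BddAddMeasure (volume.restrict U) ℝ)
          (μ : BddAddMeasure (volume.restrict U) (EuclideanSpace ℝ (Fin n))),
          lam.core ⊆ frontier Ω ∧ μ.core ⊆ frontier Ω ∧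
            ∀ δ : ℝ, 0 < δ → IsNormalTrace Ω F δ lam μ) ↔
        liminf (fun δ : ℝ => tentTraceBound U Ω F δ) (𝓝[>] 0) < ⊤) ∧
      ∀ (lam : BddAddMeasure (volume.restrict U) ℝ)
        (μ : BddAddMeasure (volume.restrict U) (EuclideanSpace ℝ (Fin n))),
        lam.core ⊆ frontier Ω → μ.core ⊆ frontier Ω →
          (∃ δ : ℝ, 0 < δ ∧ IsNormalTrace Ω F δ lam μ) →
            ∀ W : Set (EuclideanSpace ℝ (Fin n)), IsOpen W → frontier Ω ⊆ W →
              GaussGreenOn Ω F (W ∩ U) lam μ) ∧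
    -- (2) no gradient term, for a given neighbourhood
    (∀ δ : ℝ, 0 < δ →
      ((∃ lam : BddAddMeasure (volume.restrict U) ℝ, IsNormalTrace Ω F δ lam 0) ↔
        supTraceBound U Ω F δ < ⊤)) ∧
    -- (3) no gradient term, and core in the boundary
    ((∃ lam : BddAddMeasure (volume.restrict U) ℝ,
        lam.core ⊆ frontier Ω ∧ ∀ δ : ℝ, 0 < δ → IsNormalTrace Ω F δ lam 0) ↔
      liminf (fun δ : ℝ => supTraceBound U Ω F δ) (𝓝[>] 0) < ⊤) := by
  have htent : liminf (fun δ : ℝ => tentTraceBound U Ω F δ) (𝓝[>] 0) =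
      liminf (fun δ : ℝ => weightedTraceBound 1 U Ω F δ) (𝓝[>] 0) :=
    liminf_congr (eventually_mem_nhdsWithin.mono fun δ hδ =>
      tentTraceBound_eq hUo hUb hΩ hΩU hF hδ)
  simp only [htent, supTraceBound_eq]
  refine ⟨⟨⟨?_, fun h => ?_⟩, ?_⟩, fun δ hδ => ⟨?_, fun h => ?_⟩, ?_, fun h => ?_⟩
  · rintro ⟨lam, μ, -, -, h⟩
    exact liminf_lt_top_of_le fun δ hδ => weightedTraceBound_one_le hUo (h δ hδ).2.2
  · obtain ⟨C, hC, hb⟩ := exists_le_of_liminf_lt_top h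
    obtain ⟨lam, μ, -, h⟩ := exists_isNormalTrace_of_bound hUo hUb hF ENNReal.one_ne_top hC hb
    exact ⟨lam, μ, h⟩
  · rintro lam μ hlam hμ ⟨δ, hδ, h⟩ W hW hΩW
    exact h.gaussGreenOn hUo hUb hlam hμ hδ hW hΩW
  · rintro ⟨lam, h⟩
    exact (weightedTraceBound_zero_le hUo h.2.2).trans_lt (EReal.coe_lt_top _)
  · obtain ⟨C, hC, hb⟩ := exists_le_of_weightedTraceBound_lt_top h
    -- With `δ` fixed, the directed family consists of the single set `(∂Ω)_δ ∩ U`.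
    obtain ⟨lam, μ, h0, hl, hm, hG⟩ := exists_gaussGreenOn (ι := Unit) hUo hUb hF ENNReal.zero_ne_top
      (A := fun _ => bdryNhd U Ω δ) (fun _ => measurableSet_bdryNhd hUo δ)
      (fun _ => inter_subset_right) (fun i _ => ⟨i, Subset.rfl, Subset.rfl⟩) hC
      fun _ φ => divOn_le_of_weightedTraceBound_le hUo hUb hF ENNReal.zero_ne_top hb φ
    obtain rfl := h0 rfl
    exact ⟨lam, hl (), hm (), hG ()⟩
  · rintro ⟨lam, -, h⟩
    exact liminf_lt_top_of_le fun δ hδ => weightedTraceBound_zero_le hUo (h δ hδ).2.2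
  · obtain ⟨C, hC, hb⟩ := exists_le_of_liminf_lt_top h
    obtain ⟨lam, μ, h0, hl, -, hG⟩ :=
      exists_isNormalTrace_of_bound hUo hUb hF ENNReal.zero_ne_top hC hb
    obtain rfl := h0 rfl
    exact ⟨lam, hl, hG⟩
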